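/- Let $g\ge 0$ and $-1<\alpha_1<\beta_1<\alpha_2<\beta_2<\dots<\alpha_g<\beta_g<1$. Put $E=[-1,\alpha_1]\cup[\beta_1,\alpha_2]\cup\dots\cup[\beta_g,1]$ (for $g=0$, $E=[-1,1]$) and $$w(x)=\frac1\pi\sqrt{\frac{\prod_{j=1}^g(x-\alpha_j)}{(1-x^2)\prod_{j=1}^g(x-\beta_j)}},\qquad x\in E.$$ Let $P_n$, $n\ge 0$, be the monic polynomials of degree $n$ that are orthogonal on $E$ with respect to $w$, let $h_n=\int_E P_n^2\,w\,dx$, and let $$Q_n(x)=\int_E\frac{P_n(x)-P_n(t)}{x-t}\,w(t)\,dt$$ be the polynomials of the second kind. Let $a_n,b_n$ $(n\ge 1)$ be the coefficients of the recurrence $xP_n=P_{n+1}+b_{n+1}P_n+a_nP_{n-1}$. Let $\psi(z)=\int_E\frac{w(t)\,dt}{z-t}$ for $z\in\mathbb C\setminus E$ and $\psi(x)=\frac{\pi}{i}w(x)$ for $x\in E$; at the points $\pm1,\beta_1,\dots,\beta_g$, where $\psi$ is infinite, $1/\psi^2$ is read as $0$. Let $\mathfrak K\ge 1$ be a period of the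 recurrence coefficients: $a_{n+\mathfrak K}=a_n$ for $n\ge 2$ and $b_{n+\mathfrak K}=b_n$ for $n\ge 1$. Then the following identities hold for all integers $m,n\ge 1$ and all complex $x$. 1. $$P_n(x)P_{m\mathfrak K}(x)=\begin{cases}P_{n+m\mathfrak K}(x)+\dfrac{h_{m\mathfrak K}}2\,P_{n-m\mathfrak K}(x), & n>m\mathfrak K,\\[2mm] P_{n+m\mathfrak K}(x)+\dfrac{h_n}2\,P_{m\mathfrak K-n}(x), & n<m\mathfrak K,\\[2mm] P_{2m\mathfrak K}(x)+h_{m\mathfrak K}, & n=m\mathfrak K.\end{cases}$$ 2. $$Q_n(x)P_{m\mathfrak K}(x)=\begin{cases}Q_{n+m\mathfrak K}(x)+\dfrac{h_{m\mathfrak K}}2\,Q_{n-m\mathfrak K}(x), & n\ge m\mathfrak K,\\[2mm] Q_{n+m\mathfrak K}(x)-\dfrac{h_n}2\,Q_{m\mathfrak K-n}(x), & n\le m\mathfrak K.\end{cases}$$ 3. For $1\le j\le\mathfrak K-1$, $$P_{n\mathfrak K-j}(x)=\frac1{h_j}\Big(P_{n\mathfrak K}(x)P_j(x)-\frac{Q_{n\mathfrak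 K}(x)Q_j(x)}{\psi(x)^2}\Big)\quad (x\ne\alpha_1,\dots,\alpha_g),$$ $$Q_{n\mathfrak K-j}(x)=\frac1{h_j}\big(Q_{n\mathfrak K}(x)P_j(x)-P_{n\mathfrak K}(x)Q_j(x)\big).$$ -/

import Mathlib

open MeasureTheory Polynomial

/-- The end points of the gaps of a set of bands in `[-1, 1]`:
`-1 < α₁ < β₁ < α₂ < β₂ < ⋯ < α_g < β_g < 1`. -/
structure BranchPoints (g : ℕ) where
  α : Fin g → ℝ
  β : Fin g → ℝ
  neg_one_lt : ∀ j, -1 < α j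
  left_lt_right : ∀ j, α j < β j
  right_lt_left : ∀ i j, i < j → β i < α j
  lt_one : ∀ j, β j < 1

namespace BranchPoints

variable {g : ℕ} (S : BranchPoints g)

/-- `E = [-1, α₁] ∪ [β₁, α₂] ∪ ⋯ ∪ [β_g, 1]`, that is, `[-1, 1]` without the open gaps
`(α_j, β_j)`. -/
def E : Set ℝ := Set.Icc (-1) 1 \ ⋃ j, Set.Ioo (S.α j) (S.β j)

/-- The weight function on `E`. -/
noncomputable def w (x : ℝ) : ℝ :=
  1 / Real.pi * Real.sqrt ((∏ j, (x - S.α j)) / ((1 - x ^ 2) * ∏ j, (x - S.β j)))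

/-- The inner product `∫_E p q w dx` of two real polynomials. -/
noncomputable def ip (p q : ℝ[X]) : ℝ :=
  ∫ x in S.E, p.eval x * q.eval x * S.w x

/-- The monic orthogonal polynomials of the weight `w` on `E` (the Gram–Schmidt process applied
to `1, X, X ^ 2, …`). -/
noncomputable def P (n : ℕ) : ℝ[X] :=
  X ^ n - ∑ k : Fin n, C (S.ip (X ^ n) (P k) / S.ip (P k) (P k)) * P k
termination_by n
decreasing_by exact k.isLt

/-- The squared norms `h_n = ∫_E P_n ^ 2 w dx`. -/
noncomputable def h (n : ℕ) : ℝ := S.ip (S.P n) (S.P n)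

/-- The coefficient `a_n`, `n ≥ 1`, of the three-term recurrence
`x P_n = P_{n+1} + b_{n+1} P_n + a_n P_{n-1}`. -/
noncomputable def a (n : ℕ) : ℝ := S.ip (X * S.P n) (S.P (n - 1)) / S.h (n - 1)

/-- The coefficient `b_n`, `n ≥ 1`, of the three-term recurrence
`x P_n = P_{n+1} + b_{n+1} P_n + a_n P_{n-1}`. -/
noncomputable def b (n : ℕ) : ℝ := S.ip (X * S.P (n - 1)) (S.P (n - 1)) / S.h (n - 1)

/-- The recurrence coefficients repeat with period `K`. The coefficient `a₁` is exempt: already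
for the classical Chebyshev polynomials `a₁ = 1 / 2`, while `a_n = 1 / 4` for `n ≥ 2`. -/
def HasPeriod (K : ℕ) : Prop :=
  (∀ n, 2 ≤ n → S.a (n + K) = S.a n) ∧ (∀ n, 1 ≤ n → S.b (n + K) = S.b n)

/-- The value `P_n(z)` at a complex number. -/
noncomputable def evalP (n : ℕ) (z : ℂ) : ℂ := aeval z (S.P n)

/-- The polynomials of the second kind `Q_n(z) = ∫_E (P_n(z) - P_n(t)) / (z - t) w(t) dt`. -/
noncomputable def evalQ (n : ℕ) (z : ℂ) : ℂ :=
  ∫ t in S.E, (S.evalP n z - S.evalP n (t : ℂ)) / (z - (t : ℂ)) * (S.w t : ℂ)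

open Classical in
/-- The function `ψ`: the Stieltjes transform `∫_E w(t) / (z - t) dt` of the weight off `E`, and its
boundary value from the upper half plane `(π / i) w` on `E`. (At the points `±1` and `β_j`, where
`ψ` is infinite, the value here is `0`, so that `1 / ψ ^ 2` has its correct value `0`.) -/
noncomputable def psi (z : ℂ) : ℂ :=
  if z.im = 0 ∧ z.re ∈ S.E then ((Real.pi : ℂ) / Complex.I) * (S.w z.re : ℂ)
  else ∫ t in S.E, (S.w t : ℂ) / (z - (t : ℂ))

end BranchPoints

/-! The proof compares decaying solutions of the recurrence. The weight has total mass one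
(`h_zero`), so for x > 1 the functions of the second kind satisfy q_n = P_n ψ - Q_n (`q_eq`). They
solve the three-term recurrence and behave like h_n x^(-n-1) at infinity.

The analytic input is that ψ² is the rational function `numer / denom`. An explicit branch of its
square root is holomorphic in the upper half-plane and behaves like 1/z. Its boundary values are
real off `E` and equal -iπw on `E`. Cauchy's theorem recovers the branch from these values and
identifies it with the Stieltjes transform (`stieltjes_eq_branch`).

Let M be a positive multiple of the period. From index 1 on, q_n and q_(n+M) solve the same
recurrence and both decay. Their Casoratian divided by h_(n+1) does not depend on n and tends to 0,
so it vanishes (`q_zero_mul_q_succ`). Substituting q = Pψ - Q gives u = v · `denom` · ψ with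
polynomials u and v. Since `denom` has a simple zero at 1 and `numer` has none, ψ is not rational
and both u and v vanish (`two_mul_Q_succ_and_W`). This yields 2 a_(M+1) = a_1 and a polynomial W_M =
Q_M/ψ². The recurrence then propagates, for n ≥ 1, the rule 2(P_(n+M) ± Q_(n+M)/ψ) = (P_n ±
Q_n/ψ)(P_M ± Q_M/ψ), and the Wronskian gives P_M² - Q_M²/ψ² = 2h_M.

Thus P_n P_M - P_(n+M) is half of P_n P_M - Q_n Q_M/ψ². For n ≥ M this is evaluated by multiplying
with the conjugate factor. For n < M it is identified by `reflection`: the relevant polynomial pair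
approximates ψ at infinity so well that it must be a multiple of the pair with index M - n. -/

/-! ### Integrability of products of inverse square roots. -/

theorem locallyIntegrable_inv_sqrt_abs_sub (e : ℝ) :
    LocallyIntegrable (fun x : ℝ => (Real.sqrt |x - e|)⁻¹) := by
  have h0 : LocallyIntegrable (fun x : ℝ => (Real.sqrt |x|)⁻¹) := by
    refine locallyIntegrable_of_norm_le_rpow (C := 1) (α := 1 / 2) (by simp) (by norm_num [Module.finrank_self]) ?_ ?_
    · filter_upwards with x
      rw [one_mul, Real.norm_eq_abs, Real.norm_eq_abs, abs_of_nonneg (by positivity),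
        Real.rpow_neg (abs_nonneg x), Real.sqrt_eq_rpow]
    · exact Measurable.aestronglyMeasurable (by fun_prop)
  refine (locallyIntegrable_iff).2 fun K hK => ?_
  have h1 := h0.integrableOn_isCompact (hK.image (continuous_sub_right e))
  have h2 := (measurePreserving_sub_right volume e).integrableOn_comp_preimage
    (Homeomorph.subRight e).measurableEmbedding (f := fun x : ℝ => (Real.sqrt |x|)⁻¹)
    (s := (fun x => x - e) '' K)
  rw [Set.preimage_image_eq _ (sub_left_injective)] at h2
  exact h2.2 h1

/-- No point is close to two distinct singularities: √|a - e| ≤ √|x - a| + √|x - e| bounds a product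
of two inverse roots by a multiple of their sum. Induction then dominates the whole product by an
integrable sum. -/
theorem prod_inv_sqrt_abs_sub_le (s : Finset ℝ) (hs : s.Nonempty) :
    ∃ C : ℝ, 0 ≤ C ∧ ∀ x : ℝ, ∏ e ∈ s, (Real.sqrt |x - e|)⁻¹ ≤
      C * ∑ e ∈ s, (Real.sqrt |x - e|)⁻¹ := by
  classical
  induction hs using Finset.Nonempty.cons_induction with
  | singleton a => exact ⟨1, by norm_num, fun x => by simp⟩
  | cons a s ha hs ih =>
    obtain ⟨C, hC, h⟩ := ih
    have key : ∀ e ∈ s, ∀ x : ℝ, (Real.sqrt |x - a|)⁻¹ * (Real.sqrt |x - e|)⁻¹ ≤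
        (Real.sqrt |a - e|)⁻¹ * ((Real.sqrt |x - a|)⁻¹ + (Real.sqrt |x - e|)⁻¹) := by
      intro e he x
      have hae : a - e ≠ 0 := fun h0 => ha (by rw [sub_eq_zero.1 h0]; exact he)
      -- At a singular point the inverse root is 0 by convention, so the left side vanishes.
      rcases eq_or_ne x a with rfl | hxa
      · simp; positivity
      rcases eq_or_ne x e with rfl | hxe
      · simp; positivity
      have h1 : 0 < Real.sqrt |x - a| := Real.sqrt_pos.2 (abs_pos.2 (sub_ne_zero.2 hxa))
      have h2 : 0 < Real.sqrt |x - e| := Real.sqrt_pos.2 (abs_pos.2 (sub_ne_zero.2 hxe))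
      have h3 : 0 < Real.sqrt |a - e| := Real.sqrt_pos.2 (abs_pos.2 hae)
      have h4 : Real.sqrt |a - e| ≤ Real.sqrt |x - a| + Real.sqrt |x - e| := by
        refine Real.sqrt_le_iff.2 ⟨by positivity, ?_⟩
        have := abs_sub_le a x e
        rw [abs_sub_comm a x] at this
        nlinarith [Real.sq_sqrt (abs_nonneg (x - a)), Real.sq_sqrt (abs_nonneg (x - e))]
      have h5 : (Real.sqrt |x - a|)⁻¹ + (Real.sqrt |x - e|)⁻¹ =
          (Real.sqrt |x - a| + Real.sqrt |x - e|) *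
            ((Real.sqrt |x - a|)⁻¹ * (Real.sqrt |x - e|)⁻¹) := by
        field_simp; ring
      rw [h5, ← mul_assoc]
      refine le_mul_of_one_le_left (by positivity) ?_
      rw [inv_mul_eq_div, one_le_div h3]
      exact h4
    refine ⟨C * ∑ e ∈ s, (Real.sqrt |a - e|)⁻¹, by positivity, fun x => ?_⟩
    rw [Finset.prod_cons, Finset.sum_cons]
    calc (Real.sqrt |x - a|)⁻¹ * ∏ e ∈ s, (Real.sqrt |x - e|)⁻¹
        ≤ (Real.sqrt |x - a|)⁻¹ * (C * ∑ e ∈ s, (Real.sqrt |x - e|)⁻¹) := by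
          gcongr; exact h x
      _ = C * ∑ e ∈ s, (Real.sqrt |x - a|)⁻¹ * (Real.sqrt |x - e|)⁻¹ := by
          rw [← Finset.mul_sum]; ring
      _ ≤ C * ∑ e ∈ s, (Real.sqrt |a - e|)⁻¹ *
            ((Real.sqrt |x - a|)⁻¹ + ∑ e ∈ s, (Real.sqrt |x - e|)⁻¹) := by
          refine mul_le_mul_of_nonneg_left (Finset.sum_le_sum fun e he => (key e he x).trans ?_) hC
          gcongr
          exact Finset.single_le_sum (f := fun e => (Real.sqrt |x - e|)⁻¹)
            (fun i _ => by positivity) he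
      _ = _ := by rw [← Finset.sum_mul]; ring

theorem locallyIntegrable_prod_inv_sqrt_abs_sub (s : Finset ℝ) :
    LocallyIntegrable (fun x : ℝ => ∏ e ∈ s, (Real.sqrt |x - e|)⁻¹) := by
  rcases s.eq_empty_or_nonempty with rfl | hs
  · simpa using locallyIntegrable_const (1 : ℝ)
  obtain ⟨C, hC, h⟩ := prod_inv_sqrt_abs_sub_le s hs
  have h1 : LocallyIntegrable (fun x : ℝ => C * ∑ e ∈ s, (Real.sqrt |x - e|)⁻¹) := by
    have := (locallyIntegrable_finsetSum s
      (fun e _ => locallyIntegrable_inv_sqrt_abs_sub e)).smul C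
    simpa [Pi.smul_def] using this
  refine h1.mono ?_ ?_
  · refine Measurable.aestronglyMeasurable ?_
    fun_prop
  · filter_upwards with x
    rw [Real.norm_eq_abs, Real.norm_eq_abs, abs_of_nonneg (by positivity),
      abs_of_nonneg (by positivity)]
    exact h x

/-! ### The bands and the integrability of the weight. -/

namespace BranchPoints
variable {g : ℕ} (S : BranchPoints g)

/-- The end points of the bands at which the weight is infinite. -/
noncomputable def poles : Finset ℝ := insert 1 (insert (-1) (Finset.univ.image S.β))

/-- All end points of the bands. -/
noncomputable def ends : Finset ℝ := S.poles ∪ Finset.univ.image S.α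

theorem β_injective : Function.Injective S.β := by
  intro i j hij
  rcases lt_trichotomy i j with h | h | h
  · have := S.right_lt_left i j h; have := S.left_lt_right j; linarith
  · exact h
  · have := S.right_lt_left j i h; have := S.left_lt_right i; linarith

theorem neg_one_lt_β (j : Fin g) : -1 < S.β j := (S.neg_one_lt j).trans (S.left_lt_right j)

theorem α_lt_one (j : Fin g) : S.α j < 1 := (S.left_lt_right j).trans (S.lt_one j)

theorem prod_poles {M : Type*} [CommMonoid M] (f : ℝ → M) :
    ∏ e ∈ S.poles, f e = f 1 * (f (-1) * ∏ j, f (S.β j)) := by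
  rw [poles, Finset.prod_insert, Finset.prod_insert,
    Finset.prod_image (fun i _ j _ h => S.β_injective h)]
  · simp only [Finset.mem_image, Finset.mem_univ, true_and, not_exists]
    exact fun j => (S.neg_one_lt_β j).ne'
  · simp only [Finset.mem_insert, Finset.mem_image, Finset.mem_univ, true_and, not_or, not_exists]
    exact ⟨by norm_num, fun j => (S.lt_one j).ne⟩

theorem isCompact_E : IsCompact S.E :=
  isCompact_Icc.diff (isOpen_iUnion fun _ => isOpen_Ioo)

theorem measurableSet_E : MeasurableSet S.E := S.isCompact_E.measurableSet

theorem abs_le_one_of_mem {x : ℝ} (hx : x ∈ S.E) : |x| ≤ 1 := abs_le.2 hx.1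

theorem β_mem_E (j : Fin g) : S.β j ∈ S.E := by
  refine ⟨⟨(S.neg_one_lt_β j).le, (S.lt_one j).le⟩, ?_⟩
  simp only [Set.mem_iUnion, Set.mem_Ioo, not_exists, not_and, not_lt]
  intro i hi
  rcases lt_trichotomy i j with h | h | h
  · have := S.right_lt_left i j h; have := S.left_lt_right j; linarith
  · rw [h]
  · have := S.right_lt_left j i h; linarith

theorem one_mem_E : (1 : ℝ) ∈ S.E := by
  refine ⟨by norm_num, ?_⟩
  simp only [Set.mem_iUnion, Set.mem_Ioo, not_exists, not_and, not_lt]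
  exact fun i _ => (S.lt_one i).le

theorem neg_one_mem_E : (-1 : ℝ) ∈ S.E := by
  refine ⟨by norm_num, ?_⟩
  simp only [Set.mem_iUnion, Set.mem_Ioo, not_exists, not_and, not_lt]
  intro i hi
  have := S.neg_one_lt i
  linarith

theorem not_mem_ends {x : ℝ} (hx : x ∉ S.ends) :
    x ≠ 1 ∧ x ≠ -1 ∧ (∀ j, x ≠ S.β j) ∧ (∀ j, x ≠ S.α j) := by
  simp only [ends, poles, Finset.mem_union, Finset.mem_insert, Finset.mem_image, Finset.mem_univ,
    true_and, not_or, not_exists] at hx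
  exact ⟨hx.1.1, hx.1.2.1, fun j h => hx.1.2.2 j h.symm, fun j h => hx.2 j h.symm⟩

theorem factor_pos {x : ℝ} (hx : x ∈ S.E) (hx' : x ∉ S.ends) (j : Fin g) :
    0 < (x - S.α j) / (x - S.β j) := by
  obtain ⟨-, -, hβ, hα⟩ := S.not_mem_ends hx'
  have hab := S.left_lt_right j
  rcases lt_or_gt_of_ne (hα j) with h | h
  · exact div_pos_of_neg_of_neg (by linarith) (by linarith)
  · rcases lt_or_gt_of_ne (hβ j) with h' | h'
    · exact (hx.2 (Set.mem_iUnion.2 ⟨j, h, h'⟩)).elim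
    · exact div_pos (by linarith) (by linarith)

theorem w_eq (x : ℝ) : S.w x =
    1 / Real.pi * Real.sqrt ((∏ j, (x - S.α j) / (x - S.β j)) / (1 - x ^ 2)) := by
  rw [w, Finset.prod_div_distrib, div_div, mul_comm (1 - x ^ 2)]

theorem w_nonneg (x : ℝ) : 0 ≤ S.w x := by unfold w; positivity

theorem w_pos {x : ℝ} (hx : x ∈ S.E) (hx' : x ∉ S.ends) : 0 < S.w x := by
  rw [w_eq]
  have h1 : 0 < ∏ j, (x - S.α j) / (x - S.β j) :=
    Finset.prod_pos fun j _ => S.factor_pos hx hx' j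
  obtain ⟨h2, h3, -, -⟩ := S.not_mem_ends hx'
  have h4 := hx.1.1.lt_of_ne' h3
  have h5 := hx.1.2.lt_of_ne h2
  have : 0 < 1 - x ^ 2 := by nlinarith
  have := Real.pi_pos
  have := Real.sqrt_pos.2 (div_pos h1 ‹_›)
  positivity

theorem measurable_w : Measurable S.w := by
  unfold w
  fun_prop

theorem integrableOn_w : IntegrableOn S.w S.E := by
  have h1 : IntegrableOn (fun x => 1 / Real.pi * 2 ^ g * ∏ e ∈ S.poles, (Real.sqrt |x - e|)⁻¹) S.E :=
    ((locallyIntegrable_prod_inv_sqrt_abs_sub S.poles).integrableOn_isCompact S.isCompact_E).const_mul _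
  refine h1.mono' S.measurable_w.aestronglyMeasurable ?_
  refine (ae_restrict_iff' S.measurableSet_E).2 (Filter.Eventually.of_forall fun x hx => ?_)
  rw [Real.norm_eq_abs, abs_of_nonneg (S.w_nonneg x), w, mul_assoc]
  have hpi := Real.pi_pos
  refine mul_le_mul_of_nonneg_left ?_ (by positivity)
  refine (Real.sqrt_le_sqrt (le_abs_self _)).trans ?_
  have h2 : |(∏ j, (x - S.α j)) / ((1 - x ^ 2) * ∏ j, (x - S.β j))| =
      (∏ j, |x - S.α j|) * ∏ e ∈ S.poles, |x - e|⁻¹ := by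
    rw [S.prod_poles, abs_div, abs_mul, Finset.abs_prod, Finset.abs_prod, Finset.prod_inv_distrib,
      div_eq_mul_inv, mul_inv, ← mul_assoc |x - 1|⁻¹, ← mul_inv |x - 1|, ← abs_mul,
      abs_sub_comm 1]
    congr 4
    ring
  have h3 : ∏ j, |x - S.α j| ≤ 2 ^ g := by
    have := Finset.prod_le_prod (s := Finset.univ) (f := fun j => |x - S.α j|) (g := fun _ => (2 : ℝ))
      (fun j _ => abs_nonneg _) (fun j _ => by
        have := hx.1.1; have := hx.1.2; have := S.neg_one_lt j; have := S.α_lt_one j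
        exact abs_le.2 ⟨by linarith, by linarith⟩)
    simpa using this
  rw [h2, Real.sqrt_mul (by positivity)]
  have h4 : ∀ s : Finset ℝ, Real.sqrt (∏ e ∈ s, |x - e|⁻¹) = ∏ e ∈ s, (Real.sqrt |x - e|)⁻¹ := by
    intro s
    rw [Real.sqrt_eq_iff_mul_self_eq (by positivity) (by positivity), ← Finset.prod_mul_distrib]
    refine Finset.prod_congr rfl fun e _ => ?_
    rw [← mul_inv, Real.mul_self_sqrt (abs_nonneg _)]
  rw [h4]
  refine mul_le_mul_of_nonneg_right ?_ (by positivity)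
  refine Real.sqrt_le_iff.2 ⟨by positivity, h3.trans ?_⟩
  exact le_self_pow₀ (one_le_pow₀ (by norm_num)) (by norm_num)

theorem integrableOn_mul_w {f : ℝ → ℝ} (hf : ContinuousOn f S.E) :
    IntegrableOn (fun x => f x * S.w x) S.E :=
  S.integrableOn_w.continuousOn_mul hf S.isCompact_E

/-- An interval starting at -1 lies in `E`: up to the first α, or up to 1 if there is no gap. -/
theorem volume_E_ne_zero : volume S.E ≠ 0 := by
  obtain ⟨c, hc, hcE⟩ : ∃ c : ℝ, -1 < c ∧ Set.Ioo (-1) c ⊆ S.E := by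
    rcases Nat.eq_zero_or_pos g with rfl | hg
    · exact ⟨1, by norm_num, fun x hx => ⟨Set.Ioo_subset_Icc_self hx, by simp⟩⟩
    · refine ⟨S.α ⟨0, hg⟩, S.neg_one_lt _, fun x hx => ⟨⟨hx.1.le, (hx.2.trans (S.α_lt_one _)).le⟩, ?_⟩⟩
      simp only [Set.mem_iUnion, Set.mem_Ioo, not_exists, not_and, not_lt]
      intro i hi
      exfalso
      have h2 := hx.2
      rcases eq_or_lt_of_le (show (⟨0, hg⟩ : Fin g) ≤ i from Nat.zero_le _) with h | h
      · rw [h] at h2; linarith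
      · have := S.right_lt_left _ i h; have := S.left_lt_right ⟨0, hg⟩; linarith
  refine fun h0 => ?_
  have := measure_mono_null hcE h0
  rw [Real.volume_Ioo, ENNReal.ofReal_eq_zero] at this
  linarith

theorem integrableOn_eval_mul_w (p : ℝ[X]) : IntegrableOn (fun x => p.eval x * S.w x) S.E :=
  S.integrableOn_mul_w p.continuous.continuousOn

theorem integrableOn_ip (p q : ℝ[X]) :
    IntegrableOn (fun x => p.eval x * q.eval x * S.w x) S.E := by
  simpa only [eval_mul] using S.integrableOn_eval_mul_w (p * q)

/-! ### Orthogonality and the three-term recurrence. -/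

theorem ip_eq (p q : ℝ[X]) : S.ip p q = ∫ x in S.E, (p * q).eval x * S.w x := by
  simp only [ip, eval_mul]

theorem ip_comm (p q : ℝ[X]) : S.ip p q = S.ip q p := by
  rw [ip_eq, ip_eq, mul_comm]

theorem ip_add_left (p q r : ℝ[X]) : S.ip (p + q) r = S.ip p r + S.ip q r := by
  simp only [ip_eq, add_mul, eval_add]
  exact integral_add (S.integrableOn_eval_mul_w _) (S.integrableOn_eval_mul_w _)

theorem ip_C_mul_left (c : ℝ) (p r : ℝ[X]) : S.ip (C c * p) r = c * S.ip p r := by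
  simp only [ip_eq, mul_assoc, eval_mul, eval_C]
  exact integral_const_mul _ _

theorem ip_sub_left (p q r : ℝ[X]) : S.ip (p - q) r = S.ip p r - S.ip q r := by
  simp only [ip_eq, sub_mul, eval_sub]
  exact integral_sub (S.integrableOn_eval_mul_w _) (S.integrableOn_eval_mul_w _)

theorem ip_sub_right (p q r : ℝ[X]) : S.ip r (p - q) = S.ip r p - S.ip r q := by
  rw [ip_comm, ip_sub_left, ip_comm S p, ip_comm S q]

theorem ip_C_mul_right (c : ℝ) (p r : ℝ[X]) : S.ip r (C c * p) = c * S.ip r p := by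
  rw [ip_comm, ip_C_mul_left, ip_comm]

theorem ip_zero_left (r : ℝ[X]) : S.ip 0 r = 0 := by simp [ip_eq]

theorem ip_zero_right (r : ℝ[X]) : S.ip r 0 = 0 := by simp [ip_eq]

theorem ip_sum_left {ι : Type*} (s : Finset ι) (f : ι → ℝ[X]) (r : ℝ[X]) :
    S.ip (∑ i ∈ s, f i) r = ∑ i ∈ s, S.ip (f i) r := by
  classical
  induction s using Finset.induction_on with
  | empty => simp [ip_zero_left]
  | insert a s ha ih => rw [Finset.sum_insert ha, Finset.sum_insert ha, ip_add_left, ih]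

theorem ip_mul_left (p q r : ℝ[X]) : S.ip (p * q) r = S.ip q (p * r) := by
  rw [ip_eq, ip_eq, mul_comm p q, mul_assoc]

theorem ip_self_pos {p : ℝ[X]} (hp : p ≠ 0) : 0 < S.ip p p := by
  have hnn : ∀ x, 0 ≤ (p * p).eval x * S.w x := fun x => by
    rw [eval_mul]; exact mul_nonneg (mul_self_nonneg _) (S.w_nonneg x)
  rw [ip_eq]
  refine lt_of_le_of_ne (integral_nonneg hnn) fun h0 => ?_
  have h1 := (integral_eq_zero_iff_of_nonneg hnn (S.integrableOn_eval_mul_w _)).1 h0.symm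
  have h2 := (ae_restrict_iff' S.measurableSet_E).1 h1
  have hfin : ((S.ends ∪ p.roots.toFinset : Finset ℝ) : Set ℝ).Countable := Finset.countable_toSet _
  have h3 := hfin.ae_notMem volume
  apply S.volume_E_ne_zero
  rw [← ae_eq_empty]
  filter_upwards [h2, h3] with x hx hx'
  refine propext ⟨fun hE => ?_, fun h => h.elim⟩
  simp only [Finset.coe_union, Set.mem_union, Finset.mem_coe, Multiset.mem_toFinset, not_or,
    mem_roots hp, IsRoot.def] at hx'
  have h4 := S.w_pos hE hx'.1
  have h5 := hx hE
  simp only [eval_mul, Pi.zero_apply, mul_eq_zero, or_self] at h5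
  exact h5.elim hx'.2 h4.ne'

theorem monic_degree_P (n : ℕ) : (S.P n).Monic ∧ (S.P n).degree = n := by
  induction n using Nat.strong_induction_on with
  | _ n ih =>
    have h1 : (∑ k : Fin n, C (S.ip (X ^ n) (S.P k) / S.ip (S.P k) (S.P k)) * S.P k).degree < n := by
      rw [← mem_degreeLT]
      refine Submodule.sum_mem _ fun k _ => ?_
      rw [← smul_eq_C_mul]
      refine Submodule.smul_mem _ _ ?_
      rw [mem_degreeLT, (ih k k.2).2]
      exact_mod_cast k.2
    rw [P]
    refine ⟨monic_X_pow_sub h1, ?_⟩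
    rw [degree_sub_eq_left_of_degree_lt (by rwa [degree_X_pow]), degree_X_pow]

theorem monic_P (n : ℕ) : (S.P n).Monic := (S.monic_degree_P n).1

theorem degree_P (n : ℕ) : (S.P n).degree = n := (S.monic_degree_P n).2

theorem natDegree_P (n : ℕ) : (S.P n).natDegree = n := natDegree_eq_of_degree_eq_some (S.degree_P n)

theorem P_ne_zero (n : ℕ) : S.P n ≠ 0 := (S.monic_P n).ne_zero

theorem P_zero : S.P 0 = 1 := by rw [P]; simp

theorem h_pos (n : ℕ) : 0 < S.h n := S.ip_self_pos (S.P_ne_zero n)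

theorem degree_sub_P_lt {n : ℕ} {p : ℝ[X]} (hp : p.degree < (n + 1 : ℕ)) :
    (p - C (p.coeff n) * S.P n).degree < n := by
  have hd : (p - C (p.coeff n) * S.P n).degree < (n + 1 : ℕ) := by
    rw [← mem_degreeLT] at hp ⊢
    refine Submodule.sub_mem _ hp ?_
    rw [← smul_eq_C_mul]
    refine Submodule.smul_mem _ _ ?_
    rw [mem_degreeLT, degree_P]
    exact_mod_cast n.lt_succ_self
  rw [degree_lt_iff_coeff_zero] at hd ⊢
  intro m hm
  rcases hm.eq_or_lt with rfl | hm
  · have := (S.monic_P n).coeff_natDegree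
    rw [natDegree_P] at this
    simp [this]
  · exact hd m hm

theorem ip_eq_zero_of_degree_lt {q : ℝ[X]} : ∀ {n : ℕ}, (∀ k < n, S.ip q (S.P k) = 0) →
    ∀ {p : ℝ[X]}, p.degree < n → S.ip q p = 0
  | 0, _, p, hp => by
    rw [Nat.cast_zero, ← not_le, zero_le_degree_iff, not_not] at hp
    rw [hp, ip_zero_right]
  | n + 1, hq, p, hp => by
    have h1 := ip_eq_zero_of_degree_lt (fun k hk => hq k (hk.trans n.lt_succ_self))
      (S.degree_sub_P_lt hp)
    rwa [ip_sub_right, ip_C_mul_right, hq n n.lt_succ_self, mul_zero, sub_zero] at h1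

theorem ip_P_P_eq_zero_of_lt : ∀ n j : ℕ, j < n → S.ip (S.P n) (S.P j) = 0 := by
  intro n
  induction n using Nat.strong_induction_on with
  | _ n ih =>
    intro j hj
    rw [P, ip_sub_left, ip_sum_left, Finset.sum_eq_single (⟨j, hj⟩ : Fin n)]
    · rw [ip_C_mul_left, div_mul_cancel₀ _ (S.ip_self_pos (S.P_ne_zero j)).ne', sub_self]
    · intro k _ hk
      rw [ip_C_mul_left]
      have : (k : ℕ) ≠ j := fun h => hk (Fin.ext h)
      rcases lt_or_gt_of_ne this with h | h
      · rw [S.ip_comm (S.P k) (S.P j), ih j hj k h, mul_zero]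
      · rw [ih k k.2 j h, mul_zero]
    · simp

theorem ip_P_eq_zero {n : ℕ} {p : ℝ[X]} (hp : p.degree < n) : S.ip (S.P n) p = 0 :=
  S.ip_eq_zero_of_degree_lt (S.ip_P_P_eq_zero_of_lt n) hp

theorem ip_P_of_degree_lt_succ {n : ℕ} {p : ℝ[X]} (hp : p.degree < (n + 1 : ℕ)) :
    S.ip (S.P n) p = p.coeff n * S.h n := by
  have := S.ip_P_eq_zero (S.degree_sub_P_lt hp)
  rwa [ip_sub_right, ip_C_mul_right, sub_eq_zero] at this

theorem coeff_P_self (n : ℕ) : (S.P n).coeff n = 1 := by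
  have := (S.monic_P n).coeff_natDegree
  rwa [natDegree_P] at this

theorem degree_X_mul_P (n : ℕ) : (X * S.P n).degree = ((n + 1 : ℕ) : WithBot ℕ) := by
  rw [degree_mul, degree_X, degree_P, add_comm]; rfl

theorem coeff_X_mul_P_succ (n : ℕ) : (X * S.P n).coeff (n + 1) = 1 := by
  rw [coeff_X_mul, coeff_P_self]

theorem ip_X_mul_P_P (n : ℕ) : S.ip (X * S.P (n + 1)) (S.P n) = S.h (n + 1) := by
  rw [ip_mul_left, ip_P_of_degree_lt_succ, coeff_X_mul_P_succ, one_mul]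
  rw [degree_X_mul_P]
  exact_mod_cast Nat.lt_succ_self _

theorem a_succ (n : ℕ) : S.a (n + 1) = S.h (n + 1) / S.h n := by
  rw [a, Nat.add_sub_cancel, ip_X_mul_P_P]

theorem b_succ_mul_h (n : ℕ) : S.b (n + 1) * S.h n = S.ip (X * S.P n) (S.P n) := by
  rw [b, Nat.add_sub_cancel, div_mul_cancel₀ _ (S.h_pos n).ne']

theorem a_succ_mul_h (n : ℕ) : S.a (n + 1) * S.h n = S.h (n + 1) := by
  rw [a_succ, div_mul_cancel₀ _ (S.h_pos n).ne']

/-- The difference p - P_n has degree below n and is orthogonal to all such polynomials, hence to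
itself. -/
theorem eq_P_of_orthogonal {n : ℕ} {p : ℝ[X]} (hp : p.degree < (n + 1 : ℕ)) (hc : p.coeff n = 1)
    (ho : ∀ k < n, S.ip p (S.P k) = 0) : p = S.P n := by
  have hd := S.degree_sub_P_lt hp
  rw [hc, C_1, one_mul] at hd
  by_contra hne
  have h1 := S.ip_self_pos (sub_ne_zero.2 hne)
  rw [ip_sub_left, S.ip_eq_zero_of_degree_lt ho hd, S.ip_P_eq_zero hd] at h1
  simp at h1

theorem P_one : S.P 1 = X - C (S.b 1) := by
  symm
  apply S.eq_P_of_orthogonal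
  · rw [degree_X_sub_C]; norm_num
  · simp [coeff_X]
  · intro k hk
    obtain rfl : k = 0 := by omega
    have := S.b_succ_mul_h 0
    rw [P_zero, mul_one, zero_add] at this
    rw [P_zero, ip_sub_left, ← mul_one (C (S.b 1)), ip_C_mul_left, ← this, h, P_zero, sub_self]

theorem P_add_two (n : ℕ) :
    S.P (n + 2) = (X - C (S.b (n + 2))) * S.P (n + 1) - C (S.a (n + 1)) * S.P n := by
  symm
  rw [sub_mul]
  have hm : ∀ {k m : ℕ} (c : ℝ), k < m → C c * S.P k ∈ degreeLT ℝ m := by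
    intro k m c hk
    rw [← smul_eq_C_mul]
    refine Submodule.smul_mem _ _ ?_
    rw [mem_degreeLT, degree_P]
    exact_mod_cast hk
  have hz : ∀ {k m : ℕ} (c : ℝ), k < m → (C c * S.P k).coeff m = 0 := by
    intro k m c hk
    exact coeff_eq_zero_of_degree_lt (mem_degreeLT.1 (hm c hk))
  apply S.eq_P_of_orthogonal
  · rw [← mem_degreeLT]
    refine Submodule.sub_mem _ (Submodule.sub_mem _ ?_ (hm _ (by omega))) (hm _ (by omega))
    rw [mem_degreeLT, degree_X_mul_P]
    exact_mod_cast Nat.lt_succ_self _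
  · rw [coeff_sub, coeff_sub, hz _ (by omega), hz _ (by omega), S.coeff_X_mul_P_succ (n + 1)]
    norm_num
  · intro k hk
    rw [ip_sub_left, ip_sub_left, ip_C_mul_left, ip_C_mul_left]
    rcases Nat.lt_trichotomy k n with h | rfl | h
    · rw [ip_mul_left, S.ip_P_P_eq_zero_of_lt (n + 1) k (by omega), S.ip_P_P_eq_zero_of_lt n k h,
        S.ip_P_eq_zero]
      · ring
      · rw [degree_X_mul_P]; exact_mod_cast (by omega)
    · rw [ip_X_mul_P_P, S.ip_P_P_eq_zero_of_lt _ k (by omega)]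
      have := S.a_succ_mul_h k
      rw [h] at this
      rw [this]; simp [BranchPoints.h]
    · obtain rfl : k = n + 1 := by omega
      rw [S.ip_comm (S.P n), S.ip_P_P_eq_zero_of_lt (n + 1) n (by omega), ← b_succ_mul_h, BranchPoints.h]
      ring

/-- P_(n+1) is an orthogonal projection of x P_n, and multiplication by x does not increase the norm
because |x| ≤ 1 on `E`. -/
theorem h_succ_le (n : ℕ) : S.h (n + 1) ≤ S.h n := by
  have h1 : S.h (n + 1) = S.ip (X * S.P n) (S.P (n + 1)) := by
    rw [ip_comm, ip_P_of_degree_lt_succ, coeff_X_mul_P_succ, one_mul]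
    rw [degree_X_mul_P]
    exact_mod_cast Nat.lt_succ_self _
  have h2 : S.ip (X * S.P n) (X * S.P n) ≤ S.h n := by
    refine setIntegral_mono_on (S.integrableOn_ip _ _) (S.integrableOn_ip _ _) S.measurableSet_E fun x hx => ?_
    refine mul_le_mul_of_nonneg_right ?_ (S.w_nonneg x)
    have := abs_le.1 (S.abs_le_one_of_mem hx)
    simp only [eval_mul, eval_X]
    nlinarith [mul_nonneg (show 0 ≤ 1 - x * x by nlinarith) (mul_self_nonneg ((S.P n).eval x))]
  have h3 : 0 ≤ S.ip (X * S.P n - S.P (n + 1)) (X * S.P n - S.P (n + 1)) :=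
    integral_nonneg fun x => mul_nonneg (mul_self_nonneg _) (S.w_nonneg x)
  rw [ip_sub_left, ip_sub_right, ip_sub_right, S.ip_comm (S.P (n + 1)) (X * S.P n), ← h1] at h3
  have h4 : S.ip (S.P (n + 1)) (S.P (n + 1)) = S.h (n + 1) := rfl
  linarith

theorem h_antitone : Antitone S.h := antitone_nat_of_succ_le S.h_succ_le

/-! ### Polynomials of the second kind and the Wronskian. -/

/-- The polynomials of the second kind of a weight of total mass one. -/
noncomputable def Q : ℕ → ℝ[X]
  | 0 => 0
  | 1 => 1
  | n + 2 => (X - C (S.b (n + 2))) * Q (n + 1) - C (S.a (n + 1)) * Q n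

theorem Q_zero : S.Q 0 = 0 := by rw [Q]

theorem Q_one : S.Q 1 = 1 := by rw [Q]

theorem Q_add_two (n : ℕ) :
    S.Q (n + 2) = (X - C (S.b (n + 2))) * S.Q (n + 1) - C (S.a (n + 1)) * S.Q n := by rw [Q]

theorem monic_degree_Q_succ (n : ℕ) : (S.Q (n + 1)).Monic ∧ (S.Q (n + 1)).natDegree = n := by
  induction n using Nat.strong_induction_on with
  | _ n ih =>
    rcases n with _ | n
    · simp [Q_one]
    have h1 := (monic_X_sub_C (S.b (n + 2))).mul (ih n n.lt_succ_self).1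
    have h2 : ((X - C (S.b (n + 2))) * S.Q (n + 1)).degree = ((n + 1 : ℕ) : WithBot ℕ) := by
      rw [degree_mul, degree_X_sub_C, degree_eq_natDegree (ih n n.lt_succ_self).1.ne_zero,
        (ih n n.lt_succ_self).2, add_comm]
      rfl
    have h3 : (C (S.a (n + 1)) * S.Q n).degree < ((X - C (S.b (n + 2))) * S.Q (n + 1)).degree := by
      rw [← smul_eq_C_mul]
      refine lt_of_le_of_lt (degree_smul_le _ _) ?_
      rw [h2]
      rcases n with _ | n
      · simp [Q_zero]
      · rw [degree_eq_natDegree (ih n (by omega)).1.ne_zero, (ih n (by omega)).2]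
        exact_mod_cast (by omega)
    rw [show n + 1 + 1 = n + 2 from rfl, Q_add_two]
    exact ⟨h1.sub_of_left h3, natDegree_eq_of_degree_eq_some
      ((degree_sub_eq_left_of_degree_lt h3).trans h2)⟩

theorem coeff_Q_succ (n : ℕ) : (S.Q (n + 1)).coeff n = 1 := by
  have := (S.monic_degree_Q_succ n).1.coeff_natDegree
  rwa [(S.monic_degree_Q_succ n).2] at this

/-- Each step of the recurrence multiplies the Casoratian by a_(n+1) = h_(n+1)/h_n. -/
theorem wronskian (h0 : S.h 0 = 1) (n : ℕ) :
    S.P n * S.Q (n + 1) - S.P (n + 1) * S.Q n = C (S.h n) := by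
  induction n with
  | zero => simp [P_zero, Q_zero, Q_one, h0]
  | succ n ih =>
    rw [P_add_two, Q_add_two, ← a_succ_mul_h, C_mul, ← ih]
    ring

end BranchPoints

/-! ### Contour integration in the upper half-plane. -/

open Filter Topology in
-- Cauchy's theorem on the rectangle with corners -R + iε and R + iR. The top and the two vertical
-- sides have total length at most 4R and lie where ‖h‖ ≤ c/R², so the bottom integral is at most
-- 4c/R. Dominated convergence as ε → 0 moves the bottom side to the real axis.
theorem tendsto_integral_boundary_values {h : ℂ → ℂ} {h0 : ℝ → ℂ}
    (hd : DifferentiableOn ℂ h {z | 0 < z.im}) {c r : ℝ} (hc : 0 ≤ c)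
    (hdecay : ∀ z : ℂ, 0 < z.im → r ≤ ‖z‖ → ‖h z‖ ≤ c / ‖z‖ ^ 2)
    {B : ℝ → ℝ → ℝ} (hB : ∀ R, IntervalIntegrable (B R) volume (-R) R)
    (hbd : ∀ R, ∀ᶠ ε : ℝ in 𝓝[>] 0, ∀ᵐ x : ℝ, x ∈ Set.uIoc (-R) R →
      ‖h (x + ε * Complex.I)‖ ≤ B R x)
    (hlim : ∀ᵐ x : ℝ, Tendsto (fun ε : ℝ => h (x + ε * Complex.I)) (𝓝[>] 0) (𝓝 (h0 x))) :
    Tendsto (fun R : ℝ => ∫ x in (-R)..R, h0 x) atTop (𝓝 0) := by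
  have hcont : ∀ ε : ℝ, 0 < ε → Continuous fun x : ℝ => h (x + ε * Complex.I) := by
    intro ε hε
    refine hd.continuousOn.comp_continuous (by fun_prop) fun x => ?_
    simpa using hε
  have key : ∀ R : ℝ, max 1 r ≤ R → ‖∫ x in (-R)..R, h0 x‖ ≤ 4 * c / R := by
    intro R hR
    have hR1 : 1 ≤ R := (le_max_left _ _).trans hR
    have hRr : r ≤ R := (le_max_right _ _).trans hR
    have hlimR : Tendsto (fun ε : ℝ => ∫ x in (-R)..R, h (x + ε * Complex.I)) (𝓝[>] 0)
        (𝓝 (∫ x in (-R)..R, h0 x)) := by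
      refine intervalIntegral.tendsto_integral_filter_of_dominated_convergence (B R) ?_ (hbd R)
        (hB R) (hlim.mono fun x hx _ => hx)
      filter_upwards [self_mem_nhdsWithin] with ε hε
      exact (hcont ε hε).aestronglyMeasurable
    refine le_of_tendsto hlimR.norm ?_
    have hev : ∀ᶠ ε : ℝ in 𝓝[>] 0, ε < R :=
      eventually_nhdsWithin_of_eventually_nhds (eventually_lt_nhds (by linarith))
    filter_upwards [self_mem_nhdsWithin, hev] with ε hε hεR
    have hε : 0 < ε := hε
    have hrect := Complex.integral_boundary_rect_eq_zero_of_differentiableOn h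
      (⟨-R, ε⟩ : ℂ) (⟨R, R⟩ : ℂ) (hd.mono fun z hz => by
        have := hz.2
        simp only [Set.mem_preimage] at this
        rw [Set.uIcc_of_le hεR.le] at this
        exact lt_of_lt_of_le hε this.1)
    simp only at hrect
    have hdec : ∀ z : ℂ, 0 < z.im → R ≤ ‖z‖ → ‖h z‖ ≤ c / R ^ 2 := by
      intro z hz hzR
      refine (hdecay z hz (hRr.trans hzR)).trans ?_
      gcongr
    have htop : ‖∫ x in (-R)..R, h (x + R * Complex.I)‖ ≤ c / R ^ 2 * |R - -R| := by
      refine intervalIntegral.norm_integral_le_of_norm_le_const fun x _ => hdec _ ?_ ?_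
      · simp; linarith
      · have := Complex.abs_im_le_norm (x + R * Complex.I)
        simp only [Complex.add_im, Complex.ofReal_im, Complex.mul_im, Complex.ofReal_re,
          Complex.I_im, Complex.I_re] at this
        refine le_trans ?_ this
        rw [show (0 : ℝ) + (R * 1 + 0 * 0) = R by ring]
        exact le_abs_self _
    have hside : ∀ s : ℝ, |s| = R → ‖∫ y in ε..R, h (s + y * Complex.I)‖ ≤ c / R ^ 2 * |R - ε| := by
      intro s hs
      refine intervalIntegral.norm_integral_le_of_norm_le_const fun y hy => hdec _ ?_ ?_
      · rw [Set.uIoc_of_le hεR.le] at hy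
        simpa using hε.trans hy.1
      · have := Complex.abs_re_le_norm (s + y * Complex.I)
        simpa [hs] using this
    have h1 := hside R (abs_of_pos (by linarith))
    have h2 := hside (-R) (by rw [abs_neg, abs_of_pos (by linarith)])
    rw [abs_of_pos (by linarith : 0 < R - ε)] at h1 h2
    rw [abs_of_pos (by linarith : 0 < R - -R)] at htop
    have h3 : ∫ x in (-R)..R, h (x + ε * Complex.I) = (∫ x in (-R)..R, h (x + R * Complex.I)) -
        Complex.I • (∫ y in ε..R, h (R + y * Complex.I)) +
        Complex.I • (∫ y in ε..R, h (((-R : ℝ) : ℂ) + y * Complex.I)) := by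
      linear_combination hrect
    rw [h3]
    refine (norm_add_le _ _).trans ((add_le_add_left (norm_sub_le _ _) _).trans ?_)
    rw [norm_smul, norm_smul, Complex.norm_I, one_mul, one_mul]
    have h4 : c / R ^ 2 * (R - ε) ≤ c / R ^ 2 * R := by gcongr; linarith
    have h5 : c / R ^ 2 * (R - -R) + c / R ^ 2 * R + c / R ^ 2 * R = 4 * c / R := by
      field_simp; ring
    linarith
  refine squeeze_zero_norm' ((eventually_ge_atTop _).mono key) ?_
  exact tendsto_const_nhds.div_atTop tendsto_id

open Filter Topology in
theorem tendsto_integral_poisson (x₀ : ℝ) {y₀ : ℝ} (hy : 0 < y₀) :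
    Tendsto (fun R : ℝ => ∫ x in (-R)..R, y₀ / ((x - x₀) ^ 2 + y₀ ^ 2)) atTop (𝓝 Real.pi) := by
  have h1 : (fun x : ℝ => y₀ / ((x - x₀) ^ 2 + y₀ ^ 2)) =
      fun x => y₀⁻¹ * (1 + ((x - x₀) / y₀) ^ 2)⁻¹ := by
    funext x
    have : (x - x₀) ^ 2 + y₀ ^ 2 ≠ 0 := by positivity
    have : 1 + ((x - x₀) / y₀) ^ 2 ≠ 0 := by positivity
    field_simp
    ring
  have hi : Integrable (fun x : ℝ => (1 + ((x - x₀) / y₀) ^ 2)⁻¹) :=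
    (integrable_inv_one_add_sq.comp_div hy.ne').comp_sub_right x₀
  have h2 : ∫ x : ℝ, y₀ / ((x - x₀) ^ 2 + y₀ ^ 2) = Real.pi := by
    rw [h1, integral_const_mul, integral_sub_right_eq_self (fun x => (1 + (x / y₀) ^ 2)⁻¹) x₀,
      Measure.integral_comp_div (fun x => (1 + x ^ 2)⁻¹) y₀, integral_univ_inv_one_add_sq,
      abs_of_pos hy, smul_eq_mul, ← mul_assoc, inv_mul_cancel₀ hy.ne', one_mul]
  rw [← h2]
  refine intervalIntegral_tendsto_integral ?_ tendsto_neg_atTop_atBot tendsto_id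
  rw [h1]
  exact hi.const_mul _

/-! ### The principal square root and its boundary values. -/

/-- The principal branch of the square root. -/
noncomputable def csqrt (z : ℂ) : ℂ := z ^ ((2 : ℕ) : ℂ)⁻¹

theorem csqrt_sq (z : ℂ) : csqrt z ^ 2 = z := Complex.cpow_nat_inv_pow z two_ne_zero

theorem norm_csqrt (z : ℂ) : ‖csqrt z‖ = Real.sqrt ‖z‖ := by
  rw [eq_comm, Real.sqrt_eq_iff_eq_sq (norm_nonneg _) (norm_nonneg _), ← norm_pow, csqrt_sq]

theorem csqrt_ne_zero {z : ℂ} (hz : z ≠ 0) : csqrt z ≠ 0 := fun h =>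
  hz (by rw [← csqrt_sq z, h]; simp)

theorem measurable_csqrt : Measurable csqrt := by
  unfold csqrt
  fun_prop

theorem differentiableAt_csqrt {z : ℂ} (hz : 0 < z.im) : DifferentiableAt ℂ csqrt z := by
  unfold csqrt
  exact differentiableAt_id.cpow_const (Or.inr hz.ne')

theorem csqrt_ofReal_of_nonneg {x : ℝ} (hx : 0 ≤ x) : csqrt x = (Real.sqrt x : ℝ) := by
  rw [csqrt, Real.sqrt_eq_rpow, Complex.ofReal_cpow hx]
  norm_num

theorem csqrt_ofReal_of_neg {x : ℝ} (hx : x < 0) : csqrt x = Complex.I * (Real.sqrt (-x) : ℝ) := by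
  rw [csqrt, Complex.ofReal_cpow_of_nonpos hx.le, ← Complex.ofReal_neg]
  have h1 : ((-x : ℝ) : ℂ) ^ ((2 : ℕ) : ℂ)⁻¹ = (Real.sqrt (-x) : ℝ) :=
    csqrt_ofReal_of_nonneg (by linarith)
  rw [h1, mul_comm]
  congr 1
  have : (Real.pi : ℂ) * Complex.I * ((2 : ℕ) : ℂ)⁻¹ = Real.pi / 2 * Complex.I := by
    push_cast; ring
  rw [this, Complex.exp_pi_div_two_mul_I]

open Filter Topology in
-- On its cut the principal logarithm has argument π and is continuous from the closed upper
-- half-plane. Hence the value of `csqrt` on the real axis is its boundary value from above.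
theorem tendsto_csqrt {x e : ℝ} (hx : x ≠ e) :
    Tendsto (fun ε : ℝ => csqrt ((x : ℂ) + ε * Complex.I - e)) (𝓝[>] 0)
      (𝓝 (csqrt ((x : ℂ) - e))) := by
  have hne : ((x : ℂ) - e) ≠ 0 := by exact_mod_cast sub_ne_zero.2 hx
  have h0 : Tendsto (fun ε : ℝ => (x : ℂ) + ε * Complex.I - e) (𝓝[>] 0)
      (𝓝[{z : ℂ | 0 ≤ z.im}] ((x : ℂ) - e)) := by
    refine tendsto_nhdsWithin_iff.2 ⟨?_, ?_⟩
    · have : Continuous fun ε : ℝ => (x : ℂ) + ε * Complex.I - e := by fun_prop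
      have := this.tendsto 0
      simp only [Complex.ofReal_zero, zero_mul, add_zero] at this
      exact this.mono_left nhdsWithin_le_nhds
    · filter_upwards [self_mem_nhdsWithin] with ε hε
      simpa using le_of_lt hε
  have hlog : ContinuousWithinAt Complex.log {z : ℂ | 0 ≤ z.im} ((x : ℂ) - e) := by
    rcases lt_or_gt_of_ne hx with h | h
    · exact Complex.continuousWithinAt_log_of_re_neg_of_im_zero (by simpa using h) (by simp)
    · exact (continuousAt_clog (Or.inl (by simpa using h))).continuousWithinAt
  have h1 : Tendsto (fun ε : ℝ => Complex.exp
      (Complex.log ((x : ℂ) + ε * Complex.I - e) * ((2 : ℕ) : ℂ)⁻¹)) (𝓝[>] 0)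
      (𝓝 (Complex.exp (Complex.log ((x : ℂ) - e) * ((2 : ℕ) : ℂ)⁻¹))) :=
    (Complex.continuous_exp.tendsto _).comp ((hlog.tendsto.comp h0).mul_const _)
  rw [csqrt, Complex.cpow_def_of_ne_zero hne]
  refine h1.congr' ?_
  filter_upwards [self_mem_nhdsWithin] with ε hε
  rw [csqrt, Complex.cpow_def_of_ne_zero]
  intro h
  have := congrArg Complex.im h
  simp at this
  exact hε.ne' this

theorem csqrt_div_csqrt_of_pos {a b : ℝ} (h : 0 < a / b) :
    ∃ r : ℝ, 0 ≤ r ∧ csqrt a / csqrt b = r := by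
  rcases lt_trichotomy a 0 with ha | rfl | ha
  · have hb : b < 0 := by
      by_contra hb
      exact absurd h (not_lt.2 (div_nonpos_of_nonpos_of_nonneg ha.le (not_lt.1 hb)))
    refine ⟨Real.sqrt (-a) / Real.sqrt (-b), by positivity, ?_⟩
    rw [csqrt_ofReal_of_neg ha, csqrt_ofReal_of_neg hb, mul_div_mul_left _ _ Complex.I_ne_zero]
    push_cast; rfl
  · simp at h
  · have hb : 0 < b := by
      by_contra hb
      exact absurd h (not_lt.2 (div_nonpos_of_nonneg_of_nonpos ha.le (not_lt.1 hb)))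
    refine ⟨Real.sqrt a / Real.sqrt b, by positivity, ?_⟩
    rw [csqrt_ofReal_of_nonneg ha.le, csqrt_ofReal_of_nonneg hb.le]
    push_cast; rfl

theorem exists_eq_ofReal_prod {ι : Type*} {s : Finset ι} {f : ι → ℂ}
    (h : ∀ i ∈ s, ∃ r : ℝ, 0 ≤ r ∧ f i = r) : ∃ r : ℝ, 0 ≤ r ∧ ∏ i ∈ s, f i = r := by
  classical
  induction s using Finset.induction_on with
  | empty => exact ⟨1, by norm_num, by simp⟩
  | insert a s ha ih =>
    obtain ⟨r, hr, h1⟩ := ih fun i hi => h i (Finset.mem_insert_of_mem hi)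
    obtain ⟨t, ht, h2⟩ := h a (Finset.mem_insert_self a s)
    exact ⟨t * r, by positivity, by rw [Finset.prod_insert ha, h1, h2]; push_cast; rfl⟩

/-! ### The algebraic branch: bounds and boundary values. -/

namespace BranchPoints
variable {g : ℕ} (S : BranchPoints g)

/-- The branch, on the upper half plane, of the square root of
`∏ (z - α_j) / ((z ^ 2 - 1) ∏ (z - β_j))` that behaves like `1 / z` at infinity. -/
noncomputable def branch (z : ℂ) : ℂ :=
  (∏ j, csqrt (z - S.α j) / csqrt (z - S.β j)) * (csqrt (z - (1 : ℝ)) * csqrt (z - (-1 : ℝ)))⁻¹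

theorem branch_sq (z : ℂ) : S.branch z ^ 2 =
    (∏ j, (z - S.α j)) / ((z ^ 2 - 1) * ∏ j, (z - S.β j)) := by
  rw [branch, mul_pow, inv_pow, mul_pow, ← Finset.prod_pow]
  simp only [div_pow, csqrt_sq]
  rw [Finset.prod_div_distrib, div_mul_eq_div_div_swap, div_eq_mul_inv _ (z ^ 2 - 1)]
  congr 2
  push_cast
  ring

theorem norm_branch (z : ℂ) : ‖S.branch z‖ =
    (∏ j, Real.sqrt ‖z - S.α j‖) * ∏ e ∈ S.poles, (Real.sqrt ‖z - e‖)⁻¹ := by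
  rw [branch, prod_poles, norm_mul, norm_inv, norm_mul, norm_prod]
  simp only [norm_div, norm_csqrt]
  rw [Finset.prod_div_distrib, Finset.prod_inv_distrib, mul_inv]
  ring

theorem measurable_branch : Measurable S.branch := by
  unfold branch
  have := measurable_csqrt
  fun_prop

theorem differentiableOn_branch : DifferentiableOn ℂ S.branch {z | 0 < z.im} := by
  intro z hz
  have hz : 0 < z.im := hz
  have hd : ∀ e : ℝ, DifferentiableAt ℂ (fun z : ℂ => csqrt (z - e)) z := fun e =>
    DifferentiableAt.comp (f := fun z : ℂ => z - e) z (differentiableAt_csqrt (by simpa using hz))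
      (by fun_prop)
  have hn : ∀ e : ℝ, csqrt (z - e) ≠ 0 := fun e => csqrt_ne_zero fun h => by
    have := congrArg Complex.im h
    simp at this
    exact hz.ne' this
  refine DifferentiableAt.differentiableWithinAt ?_
  unfold branch
  refine DifferentiableAt.mul ?_ (((hd 1).mul (hd (-1))).inv (mul_ne_zero (hn _) (hn _)))
  exact DifferentiableAt.fun_finsetProd fun j _ => (hd _).div (hd _) (hn _)

theorem prod_inv_norm_le {s : Finset ℝ} {x : ℝ} (hx : x ∉ s) (z : ℂ) (hz : z.re = x) :
    ∏ e ∈ s, (Real.sqrt ‖z - e‖)⁻¹ ≤ ∏ e ∈ s, (Real.sqrt |x - e|)⁻¹ := by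
  refine Finset.prod_le_prod (fun e _ => by positivity) fun e he => ?_
  have hne : x ≠ e := fun h => hx (h ▸ he)
  have h1 : 0 < |x - e| := abs_pos.2 (sub_ne_zero.2 hne)
  have h2 := Complex.abs_re_le_norm (z - e)
  rw [Complex.sub_re, hz, Complex.ofReal_re] at h2
  exact inv_anti₀ (Real.sqrt_pos.2 h1) (Real.sqrt_le_sqrt h2)

/-- A majorant of the boundary values of `branch` on `[-R, R]`. -/
noncomputable def majorant (R x : ℝ) : ℝ :=
  Real.sqrt (|R| + 2) ^ g * ∏ e ∈ S.poles, (Real.sqrt |x - e|)⁻¹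

theorem intervalIntegrable_majorant (R : ℝ) :
    IntervalIntegrable (S.majorant R) volume (-R) R :=
  ((locallyIntegrable_prod_inv_sqrt_abs_sub S.poles).integrableOn_isCompact
    isCompact_uIcc).intervalIntegrable.const_mul _

theorem norm_branch_le_majorant {R x : ℝ} (hx : x ∈ Set.uIoc (-R) R) (hx' : x ∉ S.ends) {ε : ℝ}
    (h0 : 0 ≤ ε) (h1 : ε ≤ 1) : ‖S.branch (x + ε * Complex.I)‖ ≤ S.majorant R x := by
  rw [norm_branch, majorant]
  have hp : x ∉ S.poles := fun h => hx' (Finset.mem_union_left _ h)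
  refine mul_le_mul ?_ (prod_inv_norm_le hp _ (by simp)) (by positivity) (by positivity)
  have : Real.sqrt (|R| + 2) ^ g = ∏ _j : Fin g, Real.sqrt (|R| + 2) := by simp
  rw [this]
  refine Finset.prod_le_prod (fun j _ => by positivity) fun j _ => Real.sqrt_le_sqrt ?_
  refine (Complex.norm_le_abs_re_add_abs_im _).trans ?_
  simp only [Complex.sub_re, Complex.add_re, Complex.ofReal_re, Complex.mul_re, Complex.I_re,
    Complex.I_im, Complex.ofReal_im, Complex.sub_im, Complex.add_im, Complex.mul_im]
  have h2 : |x| ≤ |R| := by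
    rcases le_total 0 R with hR | hR
    · rw [Set.uIoc_of_le (by linarith)] at hx
      rw [abs_of_nonneg hR, abs_le]
      exact ⟨hx.1.le, hx.2⟩
    · rw [Set.uIoc_of_ge (by linarith)] at hx
      rw [abs_of_nonpos hR, abs_le]
      constructor <;> linarith [hx.1, hx.2]
  have h3 := S.neg_one_lt j
  have h4 := S.α_lt_one j
  have h5 : |x - S.α j| ≤ |R| + 1 := (abs_sub _ _).trans (add_le_add h2 (abs_le.2 ⟨by linarith, h4.le⟩))
  norm_num
  rw [abs_of_nonneg h0]
  linarith

theorem norm_branch_le_div {z : ℂ} (hz : 2 ≤ ‖z‖) : ‖S.branch z‖ ≤ 2 ^ (g + 1) / ‖z‖ := by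
  have hlow : ∀ e : ℝ, |e| ≤ 1 → ‖z‖ / 2 ≤ ‖z - e‖ := by
    intro e he
    have := norm_sub_norm_le z e
    rw [Complex.norm_real, Real.norm_eq_abs] at this
    linarith
  have hup : ∀ e : ℝ, |e| ≤ 1 → ‖z - e‖ ≤ 2 * ‖z‖ := by
    intro e he
    have := norm_sub_le z e
    rw [Complex.norm_real, Real.norm_eq_abs] at this
    linarith
  have hα : ∀ j, |S.α j| ≤ 1 := fun j => abs_le.2 ⟨(S.neg_one_lt j).le, (S.α_lt_one j).le⟩
  have hβ : ∀ j, |S.β j| ≤ 1 := fun j => abs_le.2 ⟨(S.neg_one_lt_β j).le, (S.lt_one j).le⟩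
  have hz0 : 0 < ‖z‖ := by linarith
  rw [branch, norm_mul, norm_inv, norm_mul, norm_prod, norm_csqrt, norm_csqrt, div_eq_mul_inv,
    pow_succ, mul_assoc]
  refine mul_le_mul ?_ ?_ (by positivity) (by positivity)
  · have := Finset.prod_le_prod (s := Finset.univ)
      (f := fun j => ‖csqrt (z - S.α j) / csqrt (z - S.β j)‖) (g := fun _ => (2 : ℝ))
      (fun j _ => norm_nonneg _) (fun j _ => ?_)
    · simpa using this
    rw [norm_div, norm_csqrt, norm_csqrt]
    have h1 := hlow _ (hβ j)
    have h2 := hup _ (hα j)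
    rw [← Real.sqrt_div (norm_nonneg _)]
    refine Real.sqrt_le_iff.2 ⟨by norm_num, ?_⟩
    rw [div_le_iff₀ (by linarith)]
    linarith
  · have h1 := hlow 1 (by norm_num)
    have h2 := hlow (-1) (by norm_num)
    rw [← Real.sqrt_mul (norm_nonneg _), ← inv_inv (2 : ℝ), ← mul_inv]
    refine inv_anti₀ (by positivity) (Real.le_sqrt_of_sq_le ?_)
    nlinarith [norm_nonneg (z - (1 : ℝ))]

open Filter Topology in
theorem tendsto_branch {x : ℝ} (hx : x ∉ S.ends) :
    Tendsto (fun ε : ℝ => S.branch (x + ε * Complex.I)) (𝓝[>] 0) (𝓝 (S.branch x)) := by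
  obtain ⟨h1, h2, hβ, hα⟩ := S.not_mem_ends hx
  have hn : ∀ e : ℝ, x ≠ e → csqrt ((x : ℂ) - e) ≠ 0 := fun e he =>
    csqrt_ne_zero (by exact_mod_cast sub_ne_zero.2 he)
  refine Tendsto.mul (tendsto_finsetProd _ fun j _ => ?_) (Tendsto.inv₀ ?_ ?_)
  · exact (tendsto_csqrt (hα j)).div (tendsto_csqrt (hβ j)) (hn _ (hβ j))
  · exact (tendsto_csqrt h1).mul (tendsto_csqrt h2)
  · exact mul_ne_zero (hn _ h1) (hn _ h2)

theorem ae_not_mem_ends : ∀ᵐ x : ℝ, x ∉ S.ends := by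
  have hfin : ((S.ends : Finset ℝ) : Set ℝ).Countable := Finset.countable_toSet _
  exact hfin.ae_notMem volume

/-- On a band every quotient of roots is nonnegative, since the factors i cancel. Only the root of x
- 1 is imaginary, and it contributes 1/i = -i; the modulus comes from `branch_sq`. -/
theorem branch_of_mem {x : ℝ} (hx : x ∈ S.E) (hx' : x ∉ S.ends) :
    S.branch x = -Complex.I * (Real.pi * S.w x : ℝ) := by
  obtain ⟨h1, h2, -, -⟩ := S.not_mem_ends hx'
  have hx1 : 0 < x + 1 := by linarith [hx.1.1.lt_of_ne' h2]
  have hx2 : x - 1 < 0 := by linarith [hx.1.2.lt_of_ne h1]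
  obtain ⟨r, hr, hprod⟩ := exists_eq_ofReal_prod (s := Finset.univ)
    (f := fun j => csqrt ((x : ℂ) - S.α j) / csqrt ((x : ℂ) - S.β j)) fun j _ => by
      have := csqrt_div_csqrt_of_pos (S.factor_pos hx hx' j)
      simpa only [Complex.ofReal_sub] using this
  have hb : ∃ t : ℝ, 0 ≤ t ∧ S.branch x = -Complex.I * t := by
    refine ⟨r * (Real.sqrt (-(x - 1)) * Real.sqrt (x + 1))⁻¹, by positivity, ?_⟩
    rw [branch, hprod, ← Complex.ofReal_sub, ← Complex.ofReal_sub, csqrt_ofReal_of_neg hx2,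
      csqrt_ofReal_of_nonneg (by linarith), sub_neg_eq_add, mul_inv, mul_inv, Complex.inv_I]
    push_cast
    rw [mul_inv]
    ring
  obtain ⟨t, ht, hb⟩ := hb
  rw [hb]
  have hsq := S.branch_sq x
  have hnn : 0 ≤ (∏ j, (x - S.α j)) / ((1 - x ^ 2) * ∏ j, (x - S.β j)) := by
    rw [mul_comm (1 - x ^ 2), ← div_div, ← Finset.prod_div_distrib]
    exact div_nonneg (Finset.prod_nonneg fun j _ => (S.factor_pos hx hx' j).le) (by nlinarith)
  have ht2 : t ^ 2 = (∏ j, (x - S.α j)) / ((1 - x ^ 2) * ∏ j, (x - S.β j)) := by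
    rw [hb, mul_pow, neg_sq, Complex.I_sq] at hsq
    have : ((t ^ 2 : ℝ) : ℂ) =
        (((∏ j, (x - S.α j)) / ((1 - x ^ 2) * ∏ j, (x - S.β j)) : ℝ) : ℂ) := by
      push_cast
      rw [show ((1 : ℂ) - x ^ 2) = -(x ^ 2 - 1) by ring, neg_mul, div_neg, ← hsq]
      ring
    exact_mod_cast this
  have htw : t = Real.pi * S.w x := by
    rw [w, ← ht2, Real.sqrt_sq ht]
    field_simp
  rw [htw]

/-- The value is real because factors i occur in pairs. In a gap, the quotient of that gap supplies
a second 1/i next to that of x - 1; left of -1, the roots of x - 1 and x + 1 supply one each; right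
of 1 there are none. -/
theorem branch_of_not_mem {x : ℝ} (hx : x ∉ S.E) (hx' : x ∉ S.ends) :
    (starRingEnd ℂ) (S.branch x) = S.branch x := by
  obtain ⟨h1, h2, hβ, hα⟩ := S.not_mem_ends hx'
  suffices h : ∃ t : ℝ, S.branch x = t by
    obtain ⟨t, ht⟩ := h
    rw [ht, Complex.conj_ofReal]
  have hpos : ∀ j, ¬ (S.α j < x ∧ x < S.β j) → 0 < (x - S.α j) / (x - S.β j) := by
    intro j hj
    rcases lt_or_gt_of_ne (hα j) with h | h
    · exact div_pos_of_neg_of_neg (by linarith) (by linarith [S.left_lt_right j])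
    · rcases lt_or_gt_of_ne (hβ j) with h' | h'
      · exact absurd ⟨h, h'⟩ hj
      · exact div_pos (by linarith) (by linarith)
  have hfac : ∀ s : Finset (Fin g), (∀ j ∈ s, ¬ (S.α j < x ∧ x < S.β j)) →
      ∃ r : ℝ, 0 ≤ r ∧ ∏ j ∈ s, csqrt ((x : ℂ) - S.α j) / csqrt ((x : ℂ) - S.β j) = r :=
    fun s hs => exists_eq_ofReal_prod fun j hj => by
      have := csqrt_div_csqrt_of_pos (hpos j (hs j hj))
      simpa only [Complex.ofReal_sub] using this
  by_cases hI : x ∈ Set.Icc (-1 : ℝ) 1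
  · obtain ⟨i, hi⟩ : ∃ i, S.α i < x ∧ x < S.β i := by
      by_contra hcon
      push Not at hcon
      refine hx ⟨hI, ?_⟩
      simp only [Set.mem_iUnion, Set.mem_Ioo, not_exists, not_and, not_lt]
      exact hcon
    obtain ⟨r, -, hr⟩ := hfac (Finset.univ.erase i) fun j hj hcon => by
      have hji := Finset.ne_of_mem_erase hj
      rcases lt_or_gt_of_ne hji with h | h
      · linarith [S.right_lt_left _ _ h, hi.1, hcon.2]
      · linarith [S.right_lt_left _ _ h, hi.2, hcon.1]
    have hx1 : 0 < x + 1 := by linarith [hI.1.lt_of_ne' h2]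
    have hx2 : x - 1 < 0 := by linarith [hI.2.lt_of_ne h1]
    rw [branch, ← Finset.mul_prod_erase _ _ (Finset.mem_univ i), hr]
    simp only [← Complex.ofReal_sub]
    rw [csqrt_ofReal_of_neg hx2,
      csqrt_ofReal_of_nonneg (x := x - -1) (by linarith),
      csqrt_ofReal_of_nonneg (x := x - S.α i) (by linarith [hi.1]),
      csqrt_ofReal_of_neg (x := x - S.β i) (by linarith [hi.2])]
    refine ⟨-(Real.sqrt (x - S.α i) / Real.sqrt (-(x - S.β i)) * r *
      (Real.sqrt (-(x - 1)) * Real.sqrt (x - -1))⁻¹), ?_⟩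
    rw [mul_inv, mul_inv, div_mul_eq_div_div_swap, div_eq_mul_inv _ Complex.I, Complex.inv_I]
    push_cast
    rw [mul_inv]
    linear_combination (-((Real.sqrt (x - S.α i) : ℂ) / Real.sqrt (-(x - S.β i)) * r *
      ((Real.sqrt (-(x - 1)) : ℂ)⁻¹ * (Real.sqrt (x - -1) : ℂ)⁻¹))) * (-1) * Complex.I_sq
  · have hout : x < -1 ∨ 1 < x := by
      simp only [Set.mem_Icc, not_and_or, not_le] at hI
      exact hI
    obtain ⟨r, -, hr⟩ := hfac Finset.univ fun j _ hcon => by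
      rcases hout with h | h
      · linarith [S.neg_one_lt j, hcon.1]
      · linarith [S.lt_one j, hcon.2]
    rw [branch, hr]
    simp only [← Complex.ofReal_sub]
    rcases hout with h | h
    · rw [csqrt_ofReal_of_neg (by linarith), csqrt_ofReal_of_neg (by linarith)]
      refine ⟨-(r * (Real.sqrt (-(x - 1)) * Real.sqrt (-(x - -1)))⁻¹), ?_⟩
      rw [mul_mul_mul_comm, Complex.I_mul_I]
      push_cast
      rw [neg_one_mul, inv_neg]
      ring
    · rw [csqrt_ofReal_of_nonneg (by linarith), csqrt_ofReal_of_nonneg (by linarith)]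
      refine ⟨r * (Real.sqrt (x - 1) * Real.sqrt (x - -1))⁻¹, ?_⟩
      push_cast
      rfl

/-! ### The Stieltjes transform as an algebraic function. -/

/-- The Stieltjes transform of the weight. -/
noncomputable def stieltjes (z : ℂ) : ℂ := ∫ t in S.E, (S.w t : ℂ) / (z - (t : ℂ))

theorem intervalIntegrable_branch (R : ℝ) :
    IntervalIntegrable (fun x : ℝ => S.branch x) volume (-R) R := by
  refine (S.intervalIntegrable_majorant R).mono_fun'
    (S.measurable_branch.comp Complex.measurable_ofReal).aestronglyMeasurable ?_
  refine (ae_restrict_iff' measurableSet_uIoc).2 ?_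
  filter_upwards [S.ae_not_mem_ends] with x hx hxR
  simpa using S.norm_branch_le_majorant hxR hx le_rfl zero_le_one

open Filter Topology in
theorem eventually_small {y : ℝ} (hy : 0 < y) : ∀ᶠ ε : ℝ in 𝓝[>] 0, 0 < ε ∧ ε ≤ 1 ∧ ε ≤ y := by
  have h1 : ∀ᶠ ε : ℝ in 𝓝[>] 0, ε < 1 :=
    eventually_nhdsWithin_of_eventually_nhds (eventually_lt_nhds one_pos)
  have h2 : ∀ᶠ ε : ℝ in 𝓝[>] 0, ε < y :=
    eventually_nhdsWithin_of_eventually_nhds (eventually_lt_nhds hy)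
  filter_upwards [self_mem_nhdsWithin, h1, h2] with ε h0 h1 h2
  exact ⟨h0, h1.le, h2.le⟩

theorem half_norm_le_norm_sub {z c : ℂ} (hz : 2 + 2 * ‖c‖ ≤ ‖z‖) : ‖z‖ / 2 ≤ ‖z - c‖ := by
  have := norm_sub_norm_le z c
  linarith

theorem norm_div_sub_le {z c v : ℂ} {m : ℝ} (hz : 2 + 2 * ‖c‖ ≤ ‖z‖) (hm : 0 ≤ m)
    (hv : ‖v‖ ≤ m / ‖z‖) : ‖v / (z - c)‖ ≤ 2 * m / ‖z‖ ^ 2 := by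
  have h0 : 0 < ‖z‖ := by linarith [norm_nonneg c]
  rw [norm_div]
  refine (div_le_div₀ (by positivity) hv (by positivity) (half_norm_le_norm_sub hz)).trans ?_
  apply le_of_eq
  field_simp

open Filter Topology in
-- The pole lies in the lower half-plane and supplies the second order of decay. The conjugate of
-- this integral later cancels the real part of the branch.
theorem tendsto_integral_branch_div_sub_conj {z₀ : ℂ} (hz₀ : 0 < z₀.im) :
    Tendsto (fun R : ℝ => ∫ x in (-R)..R, S.branch x / ((x : ℂ) - (starRingEnd ℂ) z₀)) atTop
      (𝓝 0) := by
  have him : ∀ z : ℂ, 0 ≤ z.im → z₀.im ≤ ‖z - (starRingEnd ℂ) z₀‖ := by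
    intro z hz
    have := Complex.abs_im_le_norm (z - (starRingEnd ℂ) z₀)
    rw [Complex.sub_im, Complex.conj_im, abs_of_nonneg (by linarith)] at this
    linarith
  have hne : ∀ z : ℂ, 0 ≤ z.im → z - (starRingEnd ℂ) z₀ ≠ 0 := fun z hz =>
    norm_pos_iff.1 (hz₀.trans_le (him z hz))
  refine tendsto_integral_boundary_values (h := fun z => S.branch z / (z - (starRingEnd ℂ) z₀))
    (c := 2 * 2 ^ (g + 1)) (r := 2 + 2 * ‖(starRingEnd ℂ) z₀‖)
    (B := fun R x => S.majorant R x * z₀.im⁻¹) ?_ (by positivity) ?_ ?_ ?_ ?_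
  · exact S.differentiableOn_branch.div (by fun_prop) fun z hz => hne z (le_of_lt hz)
  · intro z _ hr
    exact norm_div_sub_le hr (by positivity)
      (S.norm_branch_le_div (by linarith [norm_nonneg ((starRingEnd ℂ) z₀)]))
  · exact fun R => (S.intervalIntegrable_majorant R).mul_const _
  · intro R
    filter_upwards [eventually_small one_pos] with ε ⟨h0, h1, _⟩
    filter_upwards [S.ae_not_mem_ends] with x hx hxR
    rw [norm_div, div_eq_mul_inv]
    have hb := S.norm_branch_le_majorant hxR hx h0.le h1
    exact mul_le_mul hb (inv_anti₀ hz₀ (him _ (by simpa using h0.le))) (by positivity)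
      ((norm_nonneg _).trans hb)
  · filter_upwards [S.ae_not_mem_ends] with x hx
    refine (S.tendsto_branch hx).div ?_ (hne x (by simp))
    have : Continuous fun ε : ℝ => (x : ℂ) + ε * Complex.I - (starRingEnd ℂ) z₀ := by fun_prop
    have := this.tendsto 0
    simp only [Complex.ofReal_zero, zero_mul, add_zero] at this
    exact this.mono_left nhdsWithin_le_nhds

open Filter Topology in
-- The subtracted term makes the numerator vanish at z₀ while remaining holomorphic in the upper
-- half-plane and of order 1/z. The singularity at z₀ is therefore removable (`dslope`), and the
-- quotient decays quadratically.
theorem tendsto_integral_branch_sub_div_sub {z₀ : ℂ} (hz₀ : 0 < z₀.im) :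
    Tendsto (fun R : ℝ => ∫ x in (-R)..R, (S.branch x - S.branch z₀ *
      ((z₀ - (starRingEnd ℂ) z₀) / ((x : ℂ) - (starRingEnd ℂ) z₀))) / ((x : ℂ) - z₀)) atTop
      (𝓝 0) := by
  set m : ℂ := S.branch z₀ with hm
  set d : ℂ := z₀ - (starRingEnd ℂ) z₀ with hd
  set F : ℂ → ℂ := fun z => S.branch z - m * (d / (z - (starRingEnd ℂ) z₀)) with hF
  have him : ∀ z : ℂ, 0 ≤ z.im → z₀.im ≤ ‖z - (starRingEnd ℂ) z₀‖ := by
    intro z hz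
    have := Complex.abs_im_le_norm (z - (starRingEnd ℂ) z₀)
    rw [Complex.sub_im, Complex.conj_im, abs_of_nonneg (by linarith)] at this
    linarith
  have hne : ∀ z : ℂ, 0 ≤ z.im → z - (starRingEnd ℂ) z₀ ≠ 0 := fun z hz =>
    norm_pos_iff.1 (hz₀.trans_le (him z hz))
  have hF0 : F z₀ = 0 := by
    simp only [hF]
    rw [hd, div_self (hne z₀ hz₀.le), mul_one, sub_self]
  have hds : ∀ z : ℂ, z ≠ z₀ → dslope F z₀ z = F z / (z - z₀) := by
    intro z hz
    rw [dslope_of_ne _ hz, slope_def_field, hF0, sub_zero]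
  have hlow : ∀ x ε : ℝ, ε ≤ z₀.im / 2 → z₀.im / 2 ≤ ‖(x : ℂ) + ε * Complex.I - z₀‖ := by
    intro x ε hε
    have := Complex.abs_im_le_norm ((x : ℂ) + ε * Complex.I - z₀)
    have h1 : ((x : ℂ) + ε * Complex.I - z₀).im = ε - z₀.im := by simp
    rw [h1, abs_sub_comm] at this
    linarith [le_abs_self (z₀.im - ε)]
  have hnex : ∀ x ε : ℝ, ε ≤ z₀.im / 2 → (x : ℂ) + ε * Complex.I - z₀ ≠ 0 := fun x ε hε =>
    norm_pos_iff.1 ((half_pos hz₀).trans_le (hlow x ε hε))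
  have hopen : IsOpen {z : ℂ | 0 < z.im} := isOpen_lt continuous_const Complex.continuous_im
  refine tendsto_integral_boundary_values (h := dslope F z₀)
    (c := 2 * (2 ^ (g + 1) + ‖m‖ * (‖d‖ * 2))) (r := 2 + 2 * ‖z₀‖)
    (B := fun R x => (S.majorant R x + ‖m‖ * (‖d‖ * z₀.im⁻¹)) * (z₀.im / 2)⁻¹)
    ?_ (by positivity) ?_ ?_ ?_ ?_
  · rw [Complex.differentiableOn_dslope (hopen.mem_nhds hz₀)]
    refine S.differentiableOn_branch.sub (DifferentiableOn.const_mul ?_ m)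
    exact (differentiableOn_const d).div (by fun_prop) fun z hz => hne z (le_of_lt hz)
  · intro z _ hr
    have hz0 : 0 < ‖z‖ := by linarith [norm_nonneg z₀]
    have hzne : z ≠ z₀ := by
      rintro rfl
      linarith [norm_nonneg z]
    rw [hds z hzne]
    refine norm_div_sub_le hr (by positivity) ((norm_sub_le _ _).trans ?_)
    rw [add_div]
    refine add_le_add (S.norm_branch_le_div (by linarith [norm_nonneg z₀])) ?_
    rw [norm_mul, norm_div, mul_div_assoc, mul_div_assoc]
    refine mul_le_mul_of_nonneg_left ?_ (norm_nonneg _)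
    rw [div_eq_mul_inv ‖d‖]
    refine mul_le_mul_of_nonneg_left ?_ (norm_nonneg _)
    rw [← inv_div]
    exact inv_anti₀ (by positivity) (half_norm_le_norm_sub (by rwa [RCLike.norm_conj]))
  · exact fun R => ((S.intervalIntegrable_majorant R).add intervalIntegrable_const).mul_const _
  · intro R
    filter_upwards [eventually_small (half_pos hz₀)] with ε ⟨h0, h1, h2⟩
    filter_upwards [S.ae_not_mem_ends] with x hx hxR
    rw [hds _ (sub_ne_zero.1 (hnex x ε h2)), norm_div, div_eq_mul_inv]
    have hb := S.norm_branch_le_majorant hxR hx h0.le h1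
    have hF1 : ‖F (x + ε * Complex.I)‖ ≤ S.majorant R x + ‖m‖ * (‖d‖ * z₀.im⁻¹) := by
      refine (norm_sub_le _ _).trans (add_le_add hb ?_)
      rw [norm_mul, norm_div, div_eq_mul_inv]
      refine mul_le_mul_of_nonneg_left (mul_le_mul_of_nonneg_left ?_ (norm_nonneg _))
        (norm_nonneg _)
      exact inv_anti₀ hz₀ (him _ (by simpa using h0.le))
    exact mul_le_mul hF1 (inv_anti₀ (half_pos hz₀) (hlow x ε h2)) (by positivity)
      ((norm_nonneg _).trans hF1)
  · filter_upwards [S.ae_not_mem_ends] with x hx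
    have hlin : ∀ c : ℂ, Tendsto (fun ε : ℝ => (x : ℂ) + ε * Complex.I - c) (𝓝[>] 0)
        (𝓝 ((x : ℂ) - c)) := by
      intro c
      have : Continuous fun ε : ℝ => (x : ℂ) + ε * Complex.I - c := by fun_prop
      have := this.tendsto 0
      simp only [Complex.ofReal_zero, zero_mul, add_zero] at this
      exact this.mono_left nhdsWithin_le_nhds
    have hx0 : (x : ℂ) - z₀ ≠ 0 := by simpa using hnex x 0 (half_pos hz₀).le
    have h1 := ((S.tendsto_branch hx).sub
      ((tendsto_const_nhds (x := d)).div (hlin ((starRingEnd ℂ) z₀)) (hne x (by simp))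
        |>.const_mul m)).div (hlin z₀) hx0
    refine h1.congr' ?_
    filter_upwards [eventually_small (half_pos hz₀)] with ε ⟨h0, h1, h2⟩
    rw [hds _ (sub_ne_zero.1 (hnex x ε h2))]
    rfl

open Filter Topology in
-- Cauchy's formula obtained from two vanishing integrals. Subtracting the conjugate of one from the
-- other leaves the branch minus its conjugate, which is 0 off `E` and -2πi w on `E`. The term
-- subtracted at z₀ is 2i times the Poisson kernel, with integral 2πi.
theorem stieltjes_eq_branch {z₀ : ℂ} (hz₀ : 0 < z₀.im) : S.stieltjes z₀ = S.branch z₀ := by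
  have hnex : ∀ x : ℝ, (x : ℂ) - z₀ ≠ 0 := fun x h => by
    have := congrArg Complex.im h
    simp at this
    exact hz₀.ne' this
  have hnex' : ∀ x : ℝ, (x : ℂ) - (starRingEnd ℂ) z₀ ≠ 0 := fun x h => by
    have := congrArg Complex.im h
    simp at this
    exact hz₀.ne' this
  have hconj := (Complex.continuous_conj.tendsto _).comp (S.tendsto_integral_branch_div_sub_conj hz₀)
  have hpois : Tendsto (fun R : ℝ => S.branch z₀ * (2 * Complex.I) *
      ((∫ x in (-R)..R, z₀.im / ((x - z₀.re) ^ 2 + z₀.im ^ 2) : ℝ) : ℂ)) atTop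
      (𝓝 (S.branch z₀ * (2 * Complex.I) * (Real.pi : ℝ))) :=
    ((Complex.continuous_ofReal.tendsto _).comp (tendsto_integral_poisson z₀.re hz₀)).const_mul _
  have htot := ((S.tendsto_integral_branch_sub_div_sub hz₀).sub hconj).add hpois
  -- Once (-R, R] contains `E`, the combined integral no longer depends on R.
  have hconst : ∀ R : ℝ, 1 < R →
      (∫ x in (-R)..R, (S.branch x - S.branch z₀ *
        ((z₀ - (starRingEnd ℂ) z₀) / ((x : ℂ) - (starRingEnd ℂ) z₀))) / ((x : ℂ) - z₀)) -
      (starRingEnd ℂ) (∫ x in (-R)..R, S.branch x / ((x : ℂ) - (starRingEnd ℂ) z₀)) +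
      S.branch z₀ * (2 * Complex.I) *
        ((∫ x in (-R)..R, z₀.im / ((x - z₀.re) ^ 2 + z₀.im ^ 2) : ℝ) : ℂ) =
      2 * Real.pi * Complex.I * S.stieltjes z₀ := by
    intro R hR
    have hb := S.intervalIntegrable_branch R
    have hcinv : ∀ c : ℂ, (∀ x : ℝ, (x : ℂ) - c ≠ 0) →
        Continuous fun x : ℝ => ((x : ℂ) - c)⁻¹ := fun c hc => by
      exact Continuous.inv₀ (by fun_prop) hc
    have hc2 : Continuous fun x : ℝ => S.branch z₀ *
        ((z₀ - (starRingEnd ℂ) z₀) / ((x : ℂ) - (starRingEnd ℂ) z₀)) := by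
      simp only [div_eq_mul_inv]
      exact ((hcinv _ hnex').const_mul _).const_mul _
    have hI1 : IntervalIntegrable (fun x : ℝ => (S.branch x - S.branch z₀ *
        ((z₀ - (starRingEnd ℂ) z₀) / ((x : ℂ) - (starRingEnd ℂ) z₀))) / ((x : ℂ) - z₀))
        volume (-R) R := by
      simp only [div_eq_mul_inv _ ((_ : ℂ) - z₀)]
      exact (hb.sub (hc2.intervalIntegrable _ _)).mul_continuousOn (hcinv _ hnex).continuousOn
    have hbc : IntervalIntegrable (fun x : ℝ => (starRingEnd ℂ) (S.branch x)) volume (-R) R := by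
      rw [intervalIntegrable_iff] at hb ⊢
      exact Complex.conjCLE.toContinuousLinearMap.integrable_comp hb
    have hI2 : IntervalIntegrable (fun x : ℝ => (starRingEnd ℂ) (S.branch x) / ((x : ℂ) - z₀))
        volume (-R) R := by
      simp only [div_eq_mul_inv]
      exact hbc.mul_continuousOn (hcinv _ hnex).continuousOn
    have hden : ∀ x : ℝ, (x - z₀.re) ^ 2 + z₀.im ^ 2 ≠ 0 := fun x => by positivity
    have hI3 : IntervalIntegrable (fun x : ℝ => S.branch z₀ * (2 * Complex.I) *
        ((z₀.im / ((x - z₀.re) ^ 2 + z₀.im ^ 2) : ℝ) : ℂ)) volume (-R) R := by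
      refine Continuous.intervalIntegrable ?_ _ _
      refine continuous_const.mul (Complex.continuous_ofReal.comp ?_)
      exact continuous_const.div (by fun_prop) hden
    have hcj : (starRingEnd ℂ) (∫ x in (-R)..R, S.branch x / ((x : ℂ) - (starRingEnd ℂ) z₀)) =
        ∫ x in (-R)..R, (starRingEnd ℂ) (S.branch x) / ((x : ℂ) - z₀) := by
      rw [intervalIntegral.integral_of_le (by linarith), intervalIntegral.integral_of_le (by linarith),
        ← integral_conj]
      simp
    rw [hcj, ← intervalIntegral.integral_ofReal, ← intervalIntegral.integral_const_mul,
      ← intervalIntegral.integral_sub hI1 hI2, ← intervalIntegral.integral_add (hI1.sub hI2) hI3,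
      intervalIntegral.integral_of_le (by linarith), stieltjes, ← integral_const_mul]
    have hsub : S.E ⊆ Set.Ioc (-R) R := fun x hx => ⟨by linarith [hx.1.1], by linarith [hx.1.2]⟩
    rw [← Set.inter_eq_self_of_subset_right hsub, ← setIntegral_indicator S.measurableSet_E]
    refine setIntegral_congr_ae measurableSet_Ioc ?_
    filter_upwards [S.ae_not_mem_ends] with x hx _
    have hkey : (((z₀.im / ((x - z₀.re) ^ 2 + z₀.im ^ 2) : ℝ)) : ℂ) * (2 * Complex.I) =
        (z₀ - (starRingEnd ℂ) z₀) / ((x : ℂ) - (starRingEnd ℂ) z₀) / ((x : ℂ) - z₀) := by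
      rw [div_div, Complex.sub_conj]
      have : ((x : ℂ) - (starRingEnd ℂ) z₀) * ((x : ℂ) - z₀) =
          (((x - z₀.re) ^ 2 + z₀.im ^ 2 : ℝ) : ℂ) := by
        apply Complex.ext
        · simp [sq]
        · simp [sq]; ring
      rw [this]
      push_cast
      ring
    have hred : (S.branch x - S.branch z₀ *
        ((z₀ - (starRingEnd ℂ) z₀) / ((x : ℂ) - (starRingEnd ℂ) z₀))) / ((x : ℂ) - z₀) -
        (starRingEnd ℂ) (S.branch x) / ((x : ℂ) - z₀) + S.branch z₀ * (2 * Complex.I) *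
        (((z₀.im / ((x - z₀.re) ^ 2 + z₀.im ^ 2) : ℝ)) : ℂ) =
        (S.branch x - (starRingEnd ℂ) (S.branch x)) / ((x : ℂ) - z₀) := by
      rw [mul_assoc, mul_comm (2 * Complex.I), hkey]
      ring
    rw [hred]
    by_cases hE : x ∈ S.E
    · rw [Set.indicator_of_mem hE, S.branch_of_mem hE hx, map_mul, Complex.conj_ofReal, map_neg,
        Complex.conj_I, ← neg_sub (x : ℂ) z₀, div_neg]
      push_cast
      ring
    · rw [Set.indicator_of_notMem hE, S.branch_of_not_mem hE hx, sub_self, zero_div]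
  have hev := htot.congr' ((eventually_gt_atTop (1 : ℝ)).mono fun R hR => hconst R hR)
  have := tendsto_nhds_unique hev tendsto_const_nhds
  rw [map_zero, sub_zero, zero_add] at this
  have hpi : (2 * Real.pi * Complex.I : ℂ) ≠ 0 := Complex.two_pi_I_ne_zero
  apply mul_left_cancel₀ hpi
  rw [← this]
  ring

/-! ### The square of ψ is rational. -/

/-- The polynomial `∏ (X - α_j)`. -/
noncomputable def numer : ℝ[X] := ∏ j, (X - C (S.α j))

/-- The polynomial `(X ^ 2 - 1) ∏ (X - β_j)`. -/
noncomputable def denom : ℝ[X] := (X ^ 2 - 1) * ∏ j, (X - C (S.β j))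

theorem aeval_numer (z : ℂ) : aeval z S.numer = ∏ j, (z - S.α j) := by
  simp [numer, map_prod]

theorem aeval_denom (z : ℂ) : aeval z S.denom = (z ^ 2 - 1) * ∏ j, (z - S.β j) := by
  simp [denom, map_prod]

theorem aeval_denom_ne_zero {z : ℂ} (hz : ¬ (z.im = 0 ∧ z.re ∈ S.E)) : aeval z S.denom ≠ 0 := by
  rw [aeval_denom, mul_ne_zero_iff, Finset.prod_ne_zero_iff]
  have key : ∀ e : ℝ, e ∈ S.E → z ≠ e := fun e he h => hz (by rw [h]; simpa using he)
  refine ⟨fun h => ?_, fun j _ => sub_ne_zero.2 (key _ (S.β_mem_E j))⟩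
  have : (z - 1) * (z + 1) = 0 := by linear_combination h
  rcases mul_eq_zero.1 this with h | h
  · exact key 1 S.one_mem_E (by push_cast; linear_combination h)
  · exact key (-1) S.neg_one_mem_E (by push_cast; linear_combination h)

theorem stieltjes_sq_of_im_pos {z : ℂ} (hz : 0 < z.im) :
    S.stieltjes z ^ 2 = aeval z S.numer / aeval z S.denom := by
  rw [S.stieltjes_eq_branch hz, branch_sq, aeval_numer, aeval_denom]

theorem stieltjes_conj (z : ℂ) :
    S.stieltjes ((starRingEnd ℂ) z) = (starRingEnd ℂ) (S.stieltjes z) := by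
  rw [stieltjes, stieltjes, ← integral_conj]
  simp

open Filter Topology in
theorem tendsto_stieltjes {x : ℝ} (hx : x ∉ S.E) :
    Tendsto (fun ε : ℝ => S.stieltjes (x + ε * Complex.I)) (𝓝[>] 0) (𝓝 (S.stieltjes x)) := by
  obtain ⟨δ, hδ, hball⟩ := Metric.isOpen_iff.1 S.isCompact_E.isClosed.isOpen_compl x hx
  have hdist : ∀ t ∈ S.E, δ ≤ |x - t| := by
    intro t ht
    by_contra hlt
    refine hball (show t ∈ Metric.ball x δ from ?_) ht
    rw [Metric.mem_ball, Real.dist_eq, abs_sub_comm]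
    exact not_le.1 hlt
  refine tendsto_integral_filter_of_dominated_convergence (fun t => S.w t * δ⁻¹) ?_ ?_ ?_ ?_
  · refine Eventually.of_forall fun ε => Measurable.aestronglyMeasurable ?_
    have := S.measurable_w
    fun_prop
  · refine Eventually.of_forall fun ε => ?_
    refine (ae_restrict_iff' S.measurableSet_E).2 (Eventually.of_forall fun t ht => ?_)
    rw [norm_div, Complex.norm_real, Real.norm_eq_abs, abs_of_nonneg (S.w_nonneg t),
      div_eq_mul_inv]
    refine mul_le_mul_of_nonneg_left (inv_anti₀ hδ ?_) (S.w_nonneg t)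
    have := Complex.abs_re_le_norm ((x : ℂ) + ε * Complex.I - t)
    refine (hdist t ht).trans ?_
    simpa using this
  · exact S.integrableOn_w.mul_const _
  · refine (ae_restrict_iff' S.measurableSet_E).2 (Eventually.of_forall fun t ht => ?_)
    have hne : (x : ℂ) - t ≠ 0 := by
      have := hdist t ht
      have h0 : x - t ≠ 0 := abs_pos.1 (hδ.trans_le this)
      exact_mod_cast h0
    refine Tendsto.div tendsto_const_nhds ?_ hne
    have : Continuous fun ε : ℝ => (x : ℂ) + ε * Complex.I - t := by fun_prop
    have := this.tendsto 0
    simp only [Complex.ofReal_zero, zero_mul, add_zero] at this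
    exact this.mono_left nhdsWithin_le_nhds

open Filter Topology in
-- The lower half-plane follows by conjugation, because the polynomials are real, and real points
-- off `E` by a limit from above.
theorem stieltjes_sq {z : ℂ} (hz : ¬ (z.im = 0 ∧ z.re ∈ S.E)) :
    S.stieltjes z ^ 2 = aeval z S.numer / aeval z S.denom := by
  rcases lt_trichotomy z.im 0 with h | h | h
  · have h1 := S.stieltjes_sq_of_im_pos (z := (starRingEnd ℂ) z) (by simpa using h)
    have h2 := congrArg (starRingEnd ℂ) h1
    rw [stieltjes_conj, map_pow, Complex.conj_conj, aeval_numer, aeval_denom] at h2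
    rw [h2, aeval_numer, aeval_denom]
    simp [map_prod]
  · obtain ⟨x, rfl⟩ : ∃ x : ℝ, z = x := ⟨z.re, Complex.ext (by simp) (by simpa using h)⟩
    have hx : x ∉ S.E := fun hx => hz (by simpa using hx)
    have h1 := (S.tendsto_stieltjes hx).pow 2
    have hlin : Tendsto (fun ε : ℝ => (x : ℂ) + ε * Complex.I) (𝓝[>] 0) (𝓝 x) := by
      have : Continuous fun ε : ℝ => (x : ℂ) + ε * Complex.I := by fun_prop
      have := this.tendsto 0
      simp only [Complex.ofReal_zero, zero_mul, add_zero] at this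
      exact this.mono_left nhdsWithin_le_nhds
    have h2 := (((Polynomial.continuous_aeval S.numer).tendsto (x : ℂ)).comp hlin).div
      (((Polynomial.continuous_aeval S.denom).tendsto (x : ℂ)).comp hlin) (S.aeval_denom_ne_zero hz)
    refine tendsto_nhds_unique h1 (h2.congr' ?_)
    filter_upwards [self_mem_nhdsWithin] with ε hε
    exact (S.stieltjes_sq_of_im_pos (by simpa using hε)).symm
  · exact S.stieltjes_sq_of_im_pos h

theorem psi_sq {z : ℂ} (hz : ∀ i, z ≠ S.α i) :
    S.psi z ^ 2 = aeval z S.numer / aeval z S.denom := by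
  rw [psi]
  split_ifs with h
  · obtain ⟨x, rfl⟩ : ∃ x : ℝ, z = x := ⟨z.re, Complex.ext (by simp) (by simpa using h.1)⟩
    have hx : x ∈ S.E := by simpa using h.2
    -- At ±1 and β_j the quotient is a division by zero, hence 0, in accordance with the value 0
    -- that `psi` takes there.
    have hnn : 0 ≤ (∏ j, (x - S.α j)) / ((1 - x ^ 2) * ∏ j, (x - S.β j)) := by
      by_cases hp : x ∈ S.ends
      · have hp' : x ∈ S.poles := by
          rcases Finset.mem_union.1 hp with h | h
          · exact h
          · obtain ⟨j, -, hj⟩ := Finset.mem_image.1 h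
            exact absurd (by rw [hj]) (hz j)
        have : (1 - x ^ 2) * ∏ j, (x - S.β j) = 0 := by
          simp only [poles, Finset.mem_insert, Finset.mem_image, Finset.mem_univ, true_and] at hp'
          rcases hp' with rfl | rfl | ⟨j, rfl⟩
          · norm_num
          · norm_num
          · rw [Finset.prod_eq_zero (Finset.mem_univ j) (sub_self _), mul_zero]
        rw [this, div_zero]
      · rw [mul_comm (1 - x ^ 2), ← div_div, ← Finset.prod_div_distrib]
        exact div_nonneg (Finset.prod_nonneg fun j _ => (S.factor_pos hx hp j).le)
          (by nlinarith [hx.1.1, hx.1.2])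
    have hw : (Real.pi * S.w x) ^ 2 = (∏ j, (x - S.α j)) / ((1 - x ^ 2) * ∏ j, (x - S.β j)) := by
      rw [w, ← mul_assoc, mul_one_div_cancel Real.pi_ne_zero, one_mul, Real.sq_sqrt hnn]
    have hw' := congrArg (fun y : ℝ => (y : ℂ)) hw
    push_cast at hw'
    rw [Complex.ofReal_re, div_mul_eq_mul_div, div_pow, hw', Complex.I_sq, aeval_numer, aeval_denom,
      ← neg_sub (1 : ℂ), neg_mul, div_neg, div_neg, div_one]
  · exact S.stieltjes_sq h

/-! ### Functions of the second kind and their decay. -/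

/-- The functions of the second kind `∫_E P_n(t) w(t) / (x - t) dt`. -/
noncomputable def q (n : ℕ) (x : ℝ) : ℝ := ∫ t in S.E, (S.P n).eval t * S.w t / (x - t)

theorem integrableOn_div_sub {f : ℝ → ℝ} (hf : ContinuousOn f S.E) {x : ℝ} (hx : 1 < x) :
    IntegrableOn (fun t => f t * S.w t / (x - t)) S.E := by
  have hc : ContinuousOn (fun t => f t / (x - t)) S.E :=
    hf.div (by fun_prop) fun t ht => by linarith [ht.1.2]
  refine (S.integrableOn_mul_w hc).congr_fun (fun t _ => ?_) S.measurableSet_E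
  ring

theorem aeval_ofReal (p : ℝ[X]) (x : ℝ) : aeval (x : ℂ) p = (p.eval x : ℝ) := by
  rw [← Complex.coe_algebraMap, aeval_algebraMap_apply]
  rfl

theorem not_mem_of_one_lt {x : ℝ} (hx : 1 < x) : ¬ ((x : ℂ).im = 0 ∧ (x : ℂ).re ∈ S.E) :=
  fun h => not_le.2 hx (by simpa using h.2.1.2)

theorem eval_denom_ne_zero {x : ℝ} (hx : 1 < x) : S.denom.eval x ≠ 0 := fun h =>
  S.aeval_denom_ne_zero (S.not_mem_of_one_lt hx) (by rw [aeval_ofReal, h, Complex.ofReal_zero])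

theorem q_zero_sq_mul {x : ℝ} (hx : 1 < x) : S.q 0 x ^ 2 * S.denom.eval x = S.numer.eval x := by
  have hz := S.not_mem_of_one_lt hx
  have h1 := S.stieltjes_sq hz
  rw [eq_div_iff (S.aeval_denom_ne_zero hz)] at h1
  have h2 : S.stieltjes x = (S.q 0 x : ℝ) := by
    rw [stieltjes, q, ← integral_complex_ofReal]
    simp [P_zero]
  rw [h2, aeval_ofReal, aeval_ofReal] at h1
  exact_mod_cast h1

open Filter Topology in
theorem tendsto_mul_integral_div_sub {f : ℝ → ℝ} (hf : ContinuousOn f S.E) :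
    Tendsto (fun x : ℝ => x * ∫ t in S.E, f t * S.w t / (x - t)) atTop
      (𝓝 (∫ t in S.E, f t * S.w t)) := by
  simp only [← integral_const_mul]
  refine tendsto_integral_filter_of_dominated_convergence (fun t => 2 * |f t * S.w t|) ?_ ?_ ?_ ?_
  · filter_upwards [eventually_gt_atTop 1] with x hx
    exact (S.integrableOn_div_sub hf hx).1.const_mul x
  · filter_upwards [eventually_ge_atTop 2] with x hx
    refine (ae_restrict_iff' S.measurableSet_E).2 (Eventually.of_forall fun t ht => ?_)
    have h1 := ht.1.2
    rw [Real.norm_eq_abs, abs_mul, abs_div, abs_of_pos (by linarith : 0 < x),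
      abs_of_pos (by linarith : 0 < x - t), mul_div_assoc', div_le_iff₀ (by linarith)]
    nlinarith [mul_nonneg (abs_nonneg (f t * S.w t)) (by linarith : (0 : ℝ) ≤ 2 * (x - t) - x)]
  · exact (S.integrableOn_mul_w hf).abs.const_mul 2
  · refine Eventually.of_forall fun t => ?_
    have h1 : Tendsto (fun x : ℝ => x / (x - t)) atTop (𝓝 1) := by
      have h2 : Tendsto (fun x : ℝ => 1 + t / (x - t)) atTop (𝓝 (1 + 0)) :=
        tendsto_const_nhds.add (tendsto_const_nhds.div_atTop (tendsto_atTop_add_const_right _ _ tendsto_id))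
      rw [add_zero] at h2
      refine h2.congr' ?_
      filter_upwards [eventually_gt_atTop t] with x hx
      have : x - t ≠ 0 := by linarith
      field_simp
      ring
    have h3 := h1.mul_const (f t * S.w t)
    rw [one_mul] at h3
    refine h3.congr fun x => ?_
    ring

theorem monic_numer : S.numer.Monic := monic_prod_of_monic _ _ fun _ _ => monic_X_sub_C _

theorem natDegree_numer : S.numer.natDegree = g := by
  rw [numer, natDegree_prod_of_monic _ _ fun _ _ => monic_X_sub_C _]
  simp

theorem monic_denom : S.denom.Monic := by
  refine Monic.mul ?_ (monic_prod_of_monic _ _ fun _ _ => monic_X_sub_C _)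
  rw [← C_1]
  exact monic_X_pow_sub_C 1 two_ne_zero

theorem natDegree_denom : S.denom.natDegree = g + 2 := by
  have h1 : (X ^ 2 - 1 : ℝ[X]).Monic := by
    rw [← C_1]
    exact monic_X_pow_sub_C 1 two_ne_zero
  rw [denom, h1.natDegree_mul (monic_prod_of_monic _ _ fun _ _ => monic_X_sub_C _),
    natDegree_prod_of_monic _ _ fun _ _ => monic_X_sub_C _, ← C_1, natDegree_X_pow_sub_C]
  simp [add_comm]

open Filter Topology in
-- As x → ∞, x q_0(x) tends to the total mass, while its square is x² `numer` / `denom`, a quotient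
-- of monic polynomials of equal degree.
theorem h_zero : S.h 0 = 1 := by
  have h1 : Tendsto (fun x : ℝ => x * S.q 0 x) atTop (𝓝 (S.h 0)) := by
    have := S.tendsto_mul_integral_div_sub (f := fun t => (S.P 0).eval t)
      (S.P 0).continuous.continuousOn
    have h2 : S.h 0 = ∫ t in S.E, (S.P 0).eval t * S.w t := by
      rw [h, ip]
      simp [P_zero]
    rw [h2]
    exact this
  have h2 : Tendsto (fun x : ℝ => (X ^ 2 * S.numer).eval x / S.denom.eval x) atTop (𝓝 1) := by
    have hm : (X ^ 2 * S.numer).Monic := (monic_X_pow 2).mul S.monic_numer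
    have := Polynomial.div_tendsto_atTop_leadingCoeff_div_of_degree_eq (X ^ 2 * S.numer) S.denom ?_
    · rwa [hm.leadingCoeff, S.monic_denom.leadingCoeff, div_one] at this
    · rw [degree_eq_natDegree hm.ne_zero, degree_eq_natDegree S.monic_denom.ne_zero,
        natDegree_denom, (monic_X_pow 2).natDegree_mul S.monic_numer, natDegree_numer,
        natDegree_X_pow, add_comm]
  have h3 : Tendsto (fun x : ℝ => (x * S.q 0 x) ^ 2) atTop (𝓝 1) := by
    refine h2.congr' ?_
    filter_upwards [eventually_gt_atTop 1] with x hx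
    rw [div_eq_iff (S.eval_denom_ne_zero hx), eval_mul, ← S.q_zero_sq_mul hx, eval_pow, eval_X]
    ring
  have h4 := tendsto_nhds_unique (h1.pow 2) h3
  nlinarith [S.h_pos 0]

/-- The transform `∫_E p(t) w(t) / (x - t) dt` of a polynomial `p`. -/
noncomputable def transform (p : ℝ[X]) (x : ℝ) : ℝ := ∫ t in S.E, p.eval t * S.w t / (x - t)

theorem q_eq_transform (n : ℕ) (x : ℝ) : S.q n x = S.transform (S.P n) x := rfl

theorem integrableOn_transform (p : ℝ[X]) {x : ℝ} (hx : 1 < x) :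
    IntegrableOn (fun t => p.eval t * S.w t / (x - t)) S.E :=
  S.integrableOn_div_sub p.continuous.continuousOn hx

theorem transform_sub (p r : ℝ[X]) {x : ℝ} (hx : 1 < x) :
    S.transform (p - r) x = S.transform p x - S.transform r x := by
  rw [transform, transform, transform, ← integral_sub (S.integrableOn_transform p hx)
    (S.integrableOn_transform r hx)]
  congr 1
  funext t
  rw [eval_sub]
  ring

theorem transform_C_mul (c : ℝ) (p : ℝ[X]) (x : ℝ) :
    S.transform (C c * p) x = c * S.transform p x := by
  rw [transform, transform, ← integral_const_mul]
  congr 1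
  funext t
  rw [eval_mul, eval_C]
  ring

theorem transform_X_sub_C_mul (p : ℝ[X]) {x : ℝ} (hx : 1 < x) :
    S.transform ((X - C x) * p) x = -S.ip 1 p := by
  rw [transform, ip, ← integral_neg]
  refine setIntegral_congr_fun S.measurableSet_E fun t ht => ?_
  have : x - t ≠ 0 := by linarith [ht.1.2]
  simp only [eval_mul, eval_sub, eval_X, eval_C, eval_one]
  field_simp
  ring

theorem transform_X_mul (p : ℝ[X]) {x : ℝ} (hx : 1 < x) :
    S.transform (X * p) x = x * S.transform p x - S.ip 1 p := by
  have h1 := S.transform_X_sub_C_mul p hx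
  rw [sub_mul, S.transform_sub _ _ hx, transform_C_mul] at h1
  linarith

theorem ip_one_P_succ (n : ℕ) : S.ip 1 (S.P (n + 1)) = 0 := by
  rw [ip_comm]
  refine S.ip_P_eq_zero ?_
  rw [degree_one]
  exact_mod_cast Nat.succ_pos n

theorem q_one {x : ℝ} (hx : 1 < x) : S.q 1 x = (x - S.b 1) * S.q 0 x - 1 := by
  rw [q_eq_transform, q_eq_transform, P_one, ← mul_one (X - C (S.b 1)), sub_mul,
    S.transform_sub _ _ hx, S.transform_X_mul _ hx, transform_C_mul, P_zero]
  have := S.h_zero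
  rw [h, P_zero] at this
  rw [this]
  ring

theorem q_add_two (n : ℕ) {x : ℝ} (hx : 1 < x) :
    S.q (n + 2) x = (x - S.b (n + 2)) * S.q (n + 1) x - S.a (n + 1) * S.q n x := by
  rw [q_eq_transform, q_eq_transform, q_eq_transform, P_add_two, sub_mul,
    S.transform_sub _ _ hx, S.transform_sub _ _ hx, S.transform_X_mul _ hx, transform_C_mul,
    transform_C_mul, ip_one_P_succ]
  ring

theorem q_eq (n : ℕ) {x : ℝ} (hx : 1 < x) :
    S.q n x = (S.P n).eval x * S.q 0 x - (S.Q n).eval x := by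
  induction n using Nat.twoStepInduction with
  | zero => simp [P_zero, Q_zero]
  | one => simp [P_one, Q_one, S.q_one hx]
  | more n ih1 ih2 =>
    rw [S.q_add_two n hx, ih1, ih2, P_add_two, Q_add_two]
    simp only [eval_sub, eval_mul, eval_X, eval_C]
    ring

/-- The divided difference (p(x) - p(t))/(x - t) has degree below n in t, so it is orthogonal to
P_n. -/
theorem eval_mul_q {n : ℕ} {p : ℝ[X]} (hp : p.degree ≤ n) {x : ℝ} (hx : 1 < x) :
    p.eval x * S.q n x = S.transform (p * S.P n) x := by
  have h1 : (X - C x) * (p /ₘ (X - C x)) = p - C (p.eval x) := by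
    have := modByMonic_add_div p (X - C x)
    rw [modByMonic_X_sub_C_eq_C_eval] at this
    linear_combination this
  have h2 : (p /ₘ (X - C x)).degree < n := by
    by_cases h0 : p = 0
    · rw [h0, zero_divByMonic, degree_zero]; exact WithBot.bot_lt_coe n
    · exact (degree_divByMonic_lt _ _ h0 (by rw [degree_X_sub_C]; norm_num)).trans_le hp
  have h3 := S.transform_X_sub_C_mul (p /ₘ (X - C x) * S.P n) hx
  rw [← mul_assoc, h1, sub_mul, S.transform_sub _ _ hx, transform_C_mul, S.ip_comm, ip_mul_left,
    mul_one, S.ip_comm] at h3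
  have h4 := S.ip_P_eq_zero h2
  rw [S.ip_comm, S.ip_comm] at h3
  rw [q_eq_transform]
  rw [S.ip_comm] at h4
  rw [h4] at h3
  linarith

/-- Here x^k q_n is the transform of X^k P_n, where |t^k| ≤ 1 and x - t ≥ x - 1 on `E`. The factor
√h_k is kept so that a product of two such bounds cancels the factor h_(n+1) of `q_cross`. -/
theorem abs_q_le {k n : ℕ} (hkn : k ≤ n) {x : ℝ} (hx : 1 < x) :
    |S.q n x| ≤ Real.sqrt (S.h k) * x⁻¹ ^ k / (x - 1) := by
  obtain ⟨s, hs, hss, hsq⟩ : ∃ s, 0 < s ∧ s * s = S.h k ∧ Real.sqrt (S.h k) = s :=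
    ⟨_, Real.sqrt_pos.2 (S.h_pos k), Real.mul_self_sqrt (S.h_pos k).le, rfl⟩
  rw [hsq]
  have h1 := S.eval_mul_q (p := X ^ k) (n := n) (by rw [degree_X_pow]; exact_mod_cast hkn) hx
  rw [eval_pow, eval_X] at h1
  have hx1 : 0 < x - 1 := by linarith
  have h2 : |S.transform (X ^ k * S.P n) x| ≤ s / (x - 1) := by
    -- Cauchy–Schwarz in the pointwise form 2|y| ≤ s + y²/s with s = √h_k; the unit mass and h_n ≤
    -- h_k then give the bound s.
    have hbound : ∀ t ∈ S.E, ‖(X ^ k * S.P n).eval t * S.w t / (x - t)‖ ≤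
        (s + (s)⁻¹ * ((S.P n).eval t * (S.P n).eval t)) / 2 * S.w t
          / (x - 1) := by
      intro t ht
      have hw := S.w_nonneg t
      have ht1 := S.abs_le_one_of_mem ht
      rw [eval_mul, eval_pow, eval_X, norm_div, norm_mul, norm_mul, norm_pow, Real.norm_eq_abs,
        Real.norm_eq_abs, Real.norm_eq_abs, Real.norm_eq_abs, abs_of_nonneg hw,
        abs_of_pos (by linarith [ht.1.2] : 0 < x - t)]
      refine div_le_div₀ (mul_nonneg (div_nonneg (add_nonneg hs.le (mul_nonneg
        (inv_nonneg.2 hs.le) (mul_self_nonneg _))) zero_le_two) hw) (mul_le_mul_of_nonneg_right ?_ hw) hx1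
        (by linarith [ht.1.2])
      refine (mul_le_of_le_one_left (abs_nonneg _) (pow_le_one₀ (abs_nonneg _) ht1)).trans ?_
      rw [← abs_mul_abs_self ((S.P n).eval t)]
      have h3 : 0 ≤ (s)⁻¹ * (|(S.P n).eval t| - s) ^ 2 := by
        positivity
      have h4 : (s)⁻¹ * (|(S.P n).eval t| - s) ^ 2 =
          (s)⁻¹ * (|(S.P n).eval t| * |(S.P n).eval t|) - 2 * |(S.P n).eval t| +
            s := by
        field_simp
        ring
      linarith
    have hint : IntegrableOn (fun t => (s + (s)⁻¹ *
        ((S.P n).eval t * (S.P n).eval t)) / 2 * S.w t / (x - 1)) S.E :=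
      (S.integrableOn_mul_w (f := fun t => (s + (s)⁻¹ *
        ((S.P n).eval t * (S.P n).eval t)) / 2) (by fun_prop)).div_const _
    have h3 := norm_integral_le_of_norm_le hint
      ((ae_restrict_iff' S.measurableSet_E).2 (Filter.Eventually.of_forall hbound))
    rw [Real.norm_eq_abs] at h3
    refine h3.trans ?_
    rw [integral_div]
    refine div_le_div_of_nonneg_right ?_ hx1.le
    have h4 : ∫ t in S.E, (s + (s)⁻¹ *
        ((S.P n).eval t * (S.P n).eval t)) / 2 * S.w t =
        s / 2 * S.h 0 + (s)⁻¹ / 2 * S.h n := by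
      rw [h, h, ip, ip, ← integral_const_mul, ← integral_const_mul, ← integral_add
        ((S.integrableOn_ip _ _).const_mul _) ((S.integrableOn_ip _ _).const_mul _)]
      congr 1
      funext t
      rw [P_zero, eval_one]
      ring
    rw [h4, h_zero]
    have h5 : (s)⁻¹ * S.h n ≤ s := by
      rw [inv_mul_le_iff₀ hs, hss]
      exact S.h_antitone hkn
    linarith
  rw [← h1, abs_mul, abs_of_pos (by positivity)] at h2
  have hxk : 0 < x ^ k := by positivity
  rw [inv_pow, mul_div_right_comm, ← div_eq_mul_inv, le_div_iff₀ hxk, mul_comm]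
  exact h2

open Filter Topology in
theorem tendsto_pow_mul_q (n : ℕ) :
    Tendsto (fun x : ℝ => x ^ (n + 1) * S.q n x) atTop (𝓝 (S.h n)) := by
  have h1 := S.tendsto_mul_integral_div_sub (f := fun t => (X ^ n * S.P n).eval t)
    (X ^ n * S.P n).continuous.continuousOn
  have h2 : ∫ t in S.E, (X ^ n * S.P n).eval t * S.w t = S.h n := by
    rw [← ip_eq, ip_comm, ip_P_of_degree_lt_succ, coeff_X_pow_self, one_mul]
    rw [degree_X_pow]
    exact_mod_cast n.lt_succ_self
  rw [h2] at h1
  refine h1.congr' ?_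
  filter_upwards [eventually_gt_atTop 1] with x hx
  have h3 := S.eval_mul_q (p := X ^ n) (n := n) (by rw [degree_X_pow]) hx
  rw [eval_pow, eval_X] at h3
  rw [pow_succ', mul_assoc, h3]
  rfl

/-! ### Periodicity: the shifted decaying solution is proportional to the original. -/

theorem HasPeriod.mul {S : BranchPoints g} {K : ℕ} (hK : S.HasPeriod K) (m : ℕ) :
    S.HasPeriod (m * K) := by
  induction m with
  | zero => exact ⟨fun n _ => by simp, fun n _ => by simp⟩
  | succ m ih =>
    refine ⟨fun n hn => ?_, fun n hn => ?_⟩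
    · rw [add_mul, one_mul, ← add_assoc, hK.1 _ (by omega), ih.1 n hn]
    · rw [add_mul, one_mul, ← add_assoc, hK.2 _ (by omega), ih.2 n hn]

/-- Both sequences obey the same recurrence, so each step multiplies their Casoratian by a_(n+2) =
h_(n+2)/h_(n+1). The first step involves a_(M+1) and a_1, which periodicity does not relate; hence
their ratio on the right. -/
theorem q_cross {M : ℕ} (hM : S.HasPeriod M) {x : ℝ} (hx : 1 < x) (n : ℕ) :
    S.q (n + 2 + M) x * S.q (n + 1) x - S.q (n + 2) x * S.q (n + 1 + M) x =
      S.h (n + 1) * (S.q 0 x * S.q (M + 1) x - S.a (M + 1) / S.a 1 * S.q 1 x * S.q M x) := by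
  have ha : S.a 1 = S.h 1 := by rw [S.a_succ 0, h_zero, div_one]
  have ha0 : S.a 1 ≠ 0 := ha ▸ (S.h_pos 1).ne'
  induction n with
  | zero =>
    rw [show 0 + 2 + M = M + 2 by ring, S.q_add_two M hx, S.q_add_two 0 hx,
      show M + 2 = 2 + M by ring, hM.2 2 (by norm_num), zero_add, add_comm 1 M, ← ha]
    field_simp
    ring
  | succ n ih =>
    rw [show n + 1 + 2 + M = (n + 1 + M) + 2 by ring, S.q_add_two (n + 1 + M) hx,
      S.q_add_two (n + 1) hx, show n + 1 + M + 2 = (n + 1 + 2) + M by ring,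
      hM.2 _ (by omega), show n + 1 + M + 1 = n + 2 + M by ring, hM.1 _ (by omega),
      show n + 1 + 1 + M = n + 2 + M by ring, show n + 1 + 1 = n + 2 from rfl,
      ← S.a_succ_mul_h (n + 1), mul_assoc, ← ih]
    ring

open Filter Topology in
-- All indices in the Casoratian are at least n + 1, so it is at most h_(n+1) times a multiple of
-- x^(-2(n+1)). After division by h_(n+1), the constant value is bounded by a null sequence.
theorem q_zero_mul_q_succ {M : ℕ} (hM : S.HasPeriod M) {x : ℝ} (hx : 1 < x) :
    S.q 0 x * S.q (M + 1) x = S.a (M + 1) / S.a 1 * S.q 1 x * S.q M x := by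
  rw [← sub_eq_zero]
  set D := S.q 0 x * S.q (M + 1) x - S.a (M + 1) / S.a 1 * S.q 1 x * S.q M x with hD
  have hx1 : 0 < x - 1 := by linarith
  have hb : ∀ n : ℕ, |D| ≤ 2 / (x - 1) ^ 2 * (x⁻¹ ^ 2) ^ (n + 1) := by
    intro n
    have h1 := S.q_cross hM hx n
    have hh := S.h_pos (n + 1)
    have h2 : S.h (n + 1) * |D| ≤
        |S.q (n + 2 + M) x| * |S.q (n + 1) x| + |S.q (n + 2) x| * |S.q (n + 1 + M) x| := by
      rw [← abs_of_pos hh, ← abs_mul, ← abs_mul, ← abs_mul, ← h1]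
      exact abs_sub _ _
    set c := Real.sqrt (S.h (n + 1)) * x⁻¹ ^ (n + 1) / (x - 1) with hc
    have hc0 : 0 ≤ c := by positivity
    have h3 : S.h (n + 1) * |D| ≤ c * c + c * c := by
      refine h2.trans (add_le_add ?_ ?_) <;>
      exact mul_le_mul (S.abs_q_le (by omega) hx) (S.abs_q_le (by omega) hx) (abs_nonneg _) hc0
    have h4 : c * c + c * c = S.h (n + 1) * (2 / (x - 1) ^ 2 * (x⁻¹ ^ 2) ^ (n + 1)) := by
      have := Real.mul_self_sqrt hh.le
      rw [hc, ← pow_mul, mul_comm 2 (n + 1), pow_mul]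
      field_simp
      linear_combination 2 * this
    rw [h4] at h3
    exact le_of_mul_le_mul_left h3 hh
  have hlim : Tendsto (fun n : ℕ => 2 / (x - 1) ^ 2 * (x⁻¹ ^ 2) ^ (n + 1)) atTop (𝓝 0) := by
    have h1 : x⁻¹ < 1 := inv_lt_one_of_one_lt₀ hx
    have h0 : 0 < x⁻¹ := by positivity
    have := ((tendsto_pow_atTop_nhds_zero_of_lt_one (r := x⁻¹ ^ 2) (by positivity)
      (by nlinarith)).comp (tendsto_add_atTop_nat 1)).const_mul (2 / (x - 1) ^ 2)
    rw [mul_zero] at this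
    exact this
  exact abs_nonpos_iff.1 (ge_of_tendsto' hlim hb)

end BranchPoints

/-! ### Separating the coefficients of 1 and ψ; translation by a period. -/

theorem Polynomial.eq_of_eval_eq_of_one_lt {p r : ℝ[X]} (h : ∀ x : ℝ, 1 < x → p.eval x = r.eval x) :
    p = r :=
  eq_of_infinite_eval_eq p r ((Set.Ioi_infinite (1 : ℝ)).mono h)

namespace BranchPoints
variable {g : ℕ} (S : BranchPoints g)

theorem eval_numer_ne_zero {x : ℝ} (hx : 1 ≤ x) : S.numer.eval x ≠ 0 := by
  rw [numer, eval_prod, Finset.prod_ne_zero_iff]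
  intro i _
  rw [eval_sub, eval_X, eval_C]
  linarith [S.α_lt_one i]

theorem rootMultiplicity_numer : S.numer.rootMultiplicity 1 = 0 :=
  rootMultiplicity_eq_zero (S.eval_numer_ne_zero le_rfl)

theorem rootMultiplicity_denom : S.denom.rootMultiplicity 1 = 1 := by
  have h1 : S.denom = (X - C 1) * ((X + 1) * ∏ j, (X - C (S.β j))) := by
    rw [denom, C_1]; ring
  have h2 : ¬ ((X + 1) * ∏ j, (X - C (S.β j))).IsRoot 1 := by
    rw [IsRoot.def, eval_mul, eval_prod, mul_eq_zero, Finset.prod_eq_zero_iff]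
    rintro (h | ⟨j, -, h⟩)
    · norm_num at h
    · rw [eval_sub, eval_X, eval_C] at h
      linarith [S.lt_one j]
  rw [h1, rootMultiplicity_mul (h1 ▸ S.monic_denom.ne_zero), rootMultiplicity_X_sub_C_self,
    rootMultiplicity_eq_zero h2]

/-- For nonzero u and v the multiplicity of the root 1 would be odd on the left and even on the
right. -/
theorem eq_zero_of_sq_mul_denom {u v : ℝ[X]} (h : u ^ 2 * S.denom = v ^ 2 * S.numer) :
    u = 0 ∧ v = 0 := by
  have hv : v = 0 := by
    by_contra hv
    have h1 : v ^ 2 * S.numer ≠ 0 := mul_ne_zero (pow_ne_zero 2 hv) S.monic_numer.ne_zero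
    have hu : u ≠ 0 := by
      rintro rfl
      exact h1 (by rw [← h]; simp)
    have h2 := congrArg (rootMultiplicity 1) h
    rw [rootMultiplicity_mul (h ▸ h1), rootMultiplicity_mul h1, rootMultiplicity_numer,
      rootMultiplicity_denom, sq, sq, rootMultiplicity_mul (mul_ne_zero hu hu),
      rootMultiplicity_mul (mul_ne_zero hv hv)] at h2
    omega
  refine ⟨?_, hv⟩
  rw [hv] at h
  simpa [S.monic_denom.ne_zero] using h

/-- The polynomial that equals `Q_M / ψ ^ 2` for a period `M`. -/
noncomputable def W (M : ℕ) : ℝ[X] := 2 * S.P (M + 1) - S.P 1 * S.P M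

/-- With q = Pψ - Q, the proportionality of decaying solutions reads u = v · `denom` · ψ. Squaring
removes ψ, and irrationality forces u = v = 0. -/
theorem two_mul_Q_succ_and_W {M : ℕ} (hM : S.HasPeriod M) (hpos : 1 ≤ M) :
    2 * S.Q (M + 1) = S.P 1 * S.Q M + S.P M ∧ S.W M * S.numer = S.Q M * S.denom ∧
      2 * S.a (M + 1) = S.a 1 := by
  set ρ := S.a (M + 1) / S.a 1 with hρ
  have ha : S.a 1 = S.h 1 := by rw [S.a_succ 0, h_zero, div_one]
  have ha0 : S.a 1 ≠ 0 := ha ▸ (S.h_pos 1).ne'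
  set u := (S.P (M + 1) - C ρ * S.P 1 * S.P M) * S.numer - C ρ * S.Q M * S.denom with hu
  set v := S.Q (M + 1) - C ρ * (S.P 1 * S.Q M + S.P M) with hv
  have huv : u ^ 2 * S.denom = (v * S.denom) ^ 2 * S.numer := by
    refine Polynomial.eq_of_eval_eq_of_one_lt fun x hx => ?_
    have h1 := S.q_zero_mul_q_succ hM hx
    rw [S.q_eq (M + 1) hx, S.q_eq M hx, S.q_eq 1 hx, Q_one, eval_one, ← hρ] at h1
    have h2 := S.q_zero_sq_mul hx
    have h3 : u.eval x = v.eval x * S.denom.eval x * S.q 0 x := by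
      simp only [hu, hv, eval_sub, eval_mul, eval_C, eval_add]
      rw [← h2]
      linear_combination S.denom.eval x * h1
    rw [eval_mul, eval_mul, eval_pow, eval_pow, eval_mul, h3, ← h2]
    ring
  obtain ⟨hu0, hv0⟩ := S.eq_zero_of_sq_mul_denom huv
  have hv0 : v = 0 := (mul_eq_zero.1 hv0).resolve_right S.monic_denom.ne_zero
  -- In v = 0 the polynomials Q_(M+1), P_1 Q_M and P_M are all monic of degree M, so 1 = 2ρ.
  have hρ2 : ρ = 1 / 2 := by
    obtain ⟨m, rfl⟩ : ∃ m, M = m + 1 := ⟨M - 1, by omega⟩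
    have h1 := congrArg (fun p => coeff p (m + 1)) hv0
    simp only [hv, coeff_sub, coeff_C_mul, coeff_add, coeff_zero, S.coeff_Q_succ (m + 1),
      S.coeff_P_self (m + 1)] at h1
    have h2 : (S.P 1 * S.Q (m + 1)).coeff (m + 1) = 1 := by
      have hm := (S.monic_P 1).mul (S.monic_degree_Q_succ m).1
      have hd := (S.monic_P 1).natDegree_mul (S.monic_degree_Q_succ m).1
      rw [natDegree_P, (S.monic_degree_Q_succ m).2, Nat.add_comm 1 m] at hd
      have := hm.coeff_natDegree
      rwa [hd] at this
    rw [h2] at h1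
    linarith
  have hC : 2 * C ρ = (1 : ℝ[X]) := by
    rw [hρ2, show (2 : ℝ[X]) = C 2 from rfl, ← C_mul]
    norm_num
  refine ⟨?_, ?_, ?_⟩
  · linear_combination 2 * hv0 + (S.P 1 * S.Q M + S.P M) * hC
  · rw [W]
    linear_combination 2 * hu0 + (S.P 1 * S.P M * S.numer + S.Q M * S.denom) * hC
  · have : S.a (M + 1) = ρ * S.a 1 := by rw [hρ, div_mul_cancel₀ _ ha0]
    rw [this, hρ2]
    ring

/-- With `W` in the role of Q_M/ψ² this is the multiplication of P + Q/ψ. Both sides satisfy the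
same recurrence in n. -/
theorem two_mul_P_add {M : ℕ} (hM : S.HasPeriod M) (hpos : 1 ≤ M) (n : ℕ) :
    2 * S.P (n + 1 + M) = S.P (n + 1) * S.P M + S.Q (n + 1) * S.W M ∧
    2 * S.Q (n + 1 + M) = S.P (n + 1) * S.Q M + S.Q (n + 1) * S.P M := by
  obtain ⟨h1, h2, h3⟩ := S.two_mul_Q_succ_and_W hM hpos
  induction n using Nat.twoStepInduction with
  | zero =>
    rw [zero_add, add_comm 1 M, Q_one, W]
    exact ⟨by ring, by rw [h1]; ring⟩
  | one =>
    -- The rule fails by a factor 2 at index 0; this relation compensates for it in the step to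
    -- index 2.
    have h4 : 2 * C (S.a (M + 1)) = C (S.a 1) := by
      rw [← h3, C_mul]; rfl
    have hP := S.P_add_two M
    have hQ := S.Q_add_two M
    have hP2 := S.P_add_two 0
    have hQ2 := S.Q_add_two 0
    rw [add_comm M 2, hM.2 2 one_le_two] at hP hQ
    rw [P_zero] at hP2
    rw [Q_zero, Q_one] at hQ2
    simp only [zero_add] at hP2 hQ2
    rw [show 1 + 1 = 2 from rfl, hP, hQ, hP2, hQ2, W]
    refine ⟨?_, ?_⟩
    · linear_combination (-S.P M) * h4
    · linear_combination (X - C (S.b 2)) * h1 + (-S.Q M) * h4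
  | more n ih1 ih2 =>
    have hP := S.P_add_two (n + 1 + M)
    have hQ := S.Q_add_two (n + 1 + M)
    have hP2 := S.P_add_two (n + 1)
    have hQ2 := S.Q_add_two (n + 1)
    rw [show n + 1 + M + 2 = n + 3 + M by ring, hM.2 _ (by omega),
      show n + 1 + M + 1 = n + 2 + M by ring, hM.1 _ (by omega)] at hP hQ
    simp only [add_assoc n, Nat.reduceAdd] at hP hQ hP2 hQ2 ih1 ih2 ⊢
    rw [hP, hQ, hP2, hQ2]
    exact ⟨by linear_combination (X - C (S.b (n + 3))) * ih2.1 - C (S.a (n + 2)) * ih1.1,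
      by linear_combination (X - C (S.b (n + 3))) * ih2.2 - C (S.a (n + 2)) * ih1.2⟩

theorem P_sq_sub {M : ℕ} (hM : S.HasPeriod M) (hpos : 1 ≤ M) :
    S.P M ^ 2 - S.Q M * S.W M = 2 * C (S.h M) := by
  obtain ⟨h1, -, -⟩ := S.two_mul_Q_succ_and_W hM hpos
  have h2 := S.wronskian S.h_zero M
  rw [W]
  linear_combination 2 * h2 - S.P M * h1

/-! ### Reflection of the index at a period. -/

open Filter Topology in
theorem tendsto_P_div_pow (n : ℕ) :
    Tendsto (fun x : ℝ => (S.P n).eval x / x ^ n) atTop (𝓝 1) := by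
  have := Polynomial.div_tendsto_atTop_leadingCoeff_div_of_degree_eq (S.P n) (X ^ n)
    (by rw [degree_P, degree_X_pow])
  simpa [(S.monic_P n).leadingCoeff] using this

open Filter Topology in
-- A Padé argument at infinity: A grows like h_j x^(M-j) and Aψ - B is of order x^(-(M-j)-1), which
-- determines the pair A, B as h_j times P_(M-j), Q_(M-j).
theorem reflection {M j : ℕ} (hM : S.HasPeriod M) (hj : 1 ≤ j) (hjM : j < M) :
    S.P M * S.P j - S.Q j * S.W M = C (S.h j) * S.P (M - j) ∧
    S.Q M * S.P j - S.P M * S.Q j = C (S.h j) * S.Q (M - j) := by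
  obtain ⟨d, rfl⟩ : ∃ d, M = j + (d + 1) := ⟨M - j - 1, by omega⟩
  rw [Nat.add_sub_cancel_left]
  set M := j + (d + 1) with hMd
  obtain ⟨-, hW, -⟩ := S.two_mul_Q_succ_and_W hM (by omega)
  set A := S.P M * S.P j - S.Q j * S.W M with hA
  set B := S.Q M * S.P j - S.P M * S.Q j with hB
  have hψ1 : Tendsto (fun x : ℝ => x * S.q 0 x) atTop (𝓝 1) := by
    have := S.tendsto_pow_mul_q 0
    rw [h_zero] at this
    simpa using this
  have hψne : ∀ x : ℝ, 1 < x → S.numer.eval x ≠ 0 ∧ S.q 0 x ≠ 0 := by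
    intro x hx
    have h0 := S.eval_numer_ne_zero hx.le
    refine ⟨h0, fun h => h0 ?_⟩
    rw [← S.q_zero_sq_mul hx, h]
    ring
  have hWx : ∀ x : ℝ, 1 < x → (S.W M).eval x * S.q 0 x ^ 2 = (S.Q M).eval x := by
    intro x hx
    have h1 := congrArg (eval x) hW
    rw [eval_mul, eval_mul, ← S.q_zero_sq_mul hx] at h1
    exact mul_right_cancel₀ (S.eval_denom_ne_zero hx) (by linear_combination h1)
  -- `Q` and `W` are eliminated through q = Pψ - Q; the middle term, of order x^(M-j), dominates.
  have hAx : ∀ x : ℝ, 1 < x → A.eval x = (S.P j).eval x * S.q M x / S.q 0 x +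
      (S.P M).eval x * S.q j x / S.q 0 x - S.q j x * S.q M x / S.q 0 x ^ 2 := by
    intro x hx
    have h0 := (hψne x hx).2
    have h1 := S.q_eq M hx
    have h2 := S.q_eq j hx
    have h3 := hWx x hx
    have h4 : (S.W M).eval x = (S.Q M).eval x / S.q 0 x ^ 2 := by
      rw [eq_div_iff (pow_ne_zero 2 h0), h3]
    rw [hA, eval_sub, eval_mul, eval_mul, h4, h1, h2]
    field_simp
    ring
  have hABx : ∀ x : ℝ, 1 < x → A.eval x * S.q 0 x - B.eval x =
      S.q M x * (2 * (S.P j).eval x - S.q j x / S.q 0 x) := by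
    intro x hx
    have h0 := (hψne x hx).2
    rw [hAx x hx, hB, eval_sub, eval_mul, eval_mul]
    have h1 := S.q_eq M hx
    have h2 := S.q_eq j hx
    have h3 : (S.Q M).eval x = (S.P M).eval x * S.q 0 x - S.q M x := by linarith
    have h4 : (S.Q j).eval x = (S.P j).eval x * S.q 0 x - S.q j x := by linarith
    rw [h3, h4]
    field_simp
    ring
  have hinv : ∀ k : ℕ, Tendsto (fun x : ℝ => (x⁻¹) ^ (k + 1)) atTop (𝓝 0) := fun k => by
    simpa using (tendsto_inv_atTop_zero (𝕜 := ℝ)).pow (k + 1)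
  have hAlim : Tendsto (fun x : ℝ => A.eval x / x ^ (d + 1)) atTop (𝓝 (S.h j)) := by
    have h1 := ((((S.tendsto_P_div_pow j).mul (S.tendsto_pow_mul_q M)).div hψ1 one_ne_zero).mul
      (hinv (2 * d + 1))).add (((S.tendsto_P_div_pow M).mul (S.tendsto_pow_mul_q j)).div hψ1
      one_ne_zero)
    have h2 := h1.sub ((((S.tendsto_pow_mul_q j).mul (S.tendsto_pow_mul_q M)).div (hψ1.pow 2)
      (by norm_num)).mul (hinv (2 * M - 1)))
    simp only [mul_zero, zero_add, one_mul, div_one, sub_zero] at h2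
    refine h2.congr' ?_
    filter_upwards [eventually_gt_atTop 1] with x hx
    rw [hAx x hx]
    have h0 := (hψne x hx).2
    have hx0 : x ≠ 0 := by linarith
    rw [show 2 * M - 1 + 1 = 2 * M by omega, hMd]
    simp only [inv_pow, pow_add, pow_mul, mul_pow, pow_one, pow_two]
    simp only [Pi.div_apply]
    field_simp
  -- The difference equals P_(d+1)(Aψ - B) - A q_(d+1). Both terms are O(1/x), and a polynomial that
  -- tends to 0 is zero.
  have hAQ : A * S.Q (d + 1) = B * S.P (d + 1) := by
    have hlim : Tendsto (fun x : ℝ => (A * S.Q (d + 1) - B * S.P (d + 1)).eval x) atTop (𝓝 0) := by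
      have h1 := ((S.tendsto_P_div_pow (d + 1)).mul ((S.tendsto_pow_mul_q M).mul
        (((S.tendsto_P_div_pow j).const_mul 2).sub
          (((S.tendsto_pow_mul_q j).div hψ1 one_ne_zero).mul (hinv (2 * j - 1)))))).mul (hinv 0)
      have h2 := h1.sub ((hAlim.mul (S.tendsto_pow_mul_q (d + 1))).mul (hinv 0))
      simp only [mul_zero, sub_zero] at h2
      refine h2.congr' ?_
      filter_upwards [eventually_gt_atTop 1] with x hx
      have h0 := (hψne x hx).2
      have hx0 : x ≠ 0 := by linarith
      have h3 := S.q_eq (d + 1) hx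
      have h4 : (A * S.Q (d + 1) - B * S.P (d + 1)).eval x =
          (S.P (d + 1)).eval x * (A.eval x * S.q 0 x - B.eval x) - A.eval x * S.q (d + 1) x := by
        rw [h3, eval_sub, eval_mul, eval_mul]
        ring
      rw [h4, hABx x hx, show 2 * j - 1 + 1 = 2 * j by omega, hMd]
      simp only [inv_pow, pow_add, pow_mul, mul_pow, pow_one, pow_two, pow_zero]
      simp only [Pi.div_apply]
      field_simp
    obtain ⟨h1, -⟩ := (Polynomial.tendsto_nhds_iff _).1 hlim
    exact sub_eq_zero.1 (leadingCoeff_eq_zero.1 h1)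
  have hwr := S.wronskian S.h_zero d
  have hCh : C (S.h d)⁻¹ * C (S.h d) = (1 : ℝ[X]) := by
    rw [← C_mul, inv_mul_cancel₀ (S.h_pos d).ne', C_1]
  -- The Wronskian is a Bézout relation for P_(d+1) and Q_(d+1), so P_(d+1) divides A; the growth of
  -- A makes the quotient constant.
  obtain ⟨r, hr⟩ : ∃ r : ℝ[X], A = S.P (d + 1) * r := by
    refine ⟨C (S.h d)⁻¹ * (S.P d * B - A * S.Q d), ?_⟩
    linear_combination (-A) * hCh - C (S.h d)⁻¹ * A * hwr + C (S.h d)⁻¹ * S.P d * hAQ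
  have hrlim : Tendsto (fun x : ℝ => r.eval x) atTop (𝓝 (S.h j)) := by
    have h1 := hAlim.div (S.tendsto_P_div_pow (d + 1)) one_ne_zero
    rw [div_one] at h1
    refine h1.congr' ?_
    have hev : ∀ᶠ x : ℝ in atTop, (S.P (d + 1)).eval x / x ^ (d + 1) ≠ 0 :=
      (S.tendsto_P_div_pow (d + 1)).eventually_ne one_ne_zero
    filter_upwards [eventually_gt_atTop 1, hev] with x hx hP
    have hx0 : x ≠ 0 := by linarith
    have hP' : (S.P (d + 1)).eval x ≠ 0 := fun h => hP (by rw [h, zero_div])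
    simp only [Pi.div_apply]
    rw [hr, eval_mul]
    field_simp
  obtain ⟨hlc, hdeg⟩ := (Polynomial.tendsto_nhds_iff _).1 hrlim
  have hrC : r = C (S.h j) := by
    rw [eq_C_of_degree_le_zero hdeg] at hlc ⊢
    rw [leadingCoeff_C] at hlc
    rw [hlc]
  have hA1 : A = C (S.h j) * S.P (d + 1) := by rw [hr, hrC, mul_comm]
  refine ⟨hA1, mul_right_cancel₀ (S.P_ne_zero (d + 1)) ?_⟩
  rw [← hAQ, hA1]
  ring

/-! ### Complex arguments and the product formulas. -/

/-- The integrals obey the recurrence of `Q`: the additional term ∫ P_(n+1) w vanishes by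
orthogonality, and t = z is a null set. -/
theorem evalQ_eq (n : ℕ) (z : ℂ) : S.evalQ n z = aeval z (S.Q n) := by
  set D : ℕ → ℝ → ℂ := fun n t =>
    (S.evalP n z - S.evalP n (t : ℂ)) / (z - (t : ℂ)) * (S.w t : ℂ) with hD
  suffices h : IntegrableOn (D n) S.E ∧ ∫ t in S.E, D n t = aeval z (S.Q n) from h.2
  have hne : ∀ᵐ t : ℝ, z - (t : ℂ) ≠ 0 := by
    filter_upwards [(Set.countable_singleton z.re).ae_notMem volume] with t ht h
    exact ht (by rw [sub_eq_zero.1 h]; simp)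
  have hPw : ∀ n, IntegrableOn (fun t : ℝ => S.evalP n (t : ℂ) * (S.w t : ℂ)) S.E ∧
      ∫ t in S.E, S.evalP n (t : ℂ) * (S.w t : ℂ) = (S.ip 1 (S.P n) : ℝ) := by
    intro n
    have h1 : (fun t : ℝ => S.evalP n (t : ℂ) * (S.w t : ℂ)) =
        fun t : ℝ => (((S.P n).eval t * S.w t : ℝ) : ℂ) := by
      funext t
      rw [evalP, aeval_ofReal]
      push_cast
      rfl
    rw [h1]
    refine ⟨(S.integrableOn_eval_mul_w (S.P n)).ofReal, ?_⟩
    rw [integral_complex_ofReal, ip]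
    simp
  induction n using Nat.twoStepInduction with
  | zero =>
    have : D 0 = fun _ => 0 := by
      funext t
      simp [hD, evalP, P_zero]
    rw [this]
    simp [Q_zero]
  | one =>
    have h1 : D 1 =ᵐ[volume.restrict S.E] fun t => S.evalP 0 (t : ℂ) * (S.w t : ℂ) := by
      filter_upwards [ae_restrict_of_ae hne] with t ht
      simp only [hD, evalP, P_one, P_zero, map_sub, aeval_X, aeval_C, map_one, one_mul]
      rw [sub_sub_sub_cancel_right, div_self ht, one_mul]
    refine ⟨(hPw 0).1.congr h1.symm, ?_⟩
    rw [integral_congr_ae h1, (hPw 0).2, Q_one, map_one, P_zero]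
    have := S.h_zero
    rw [h, P_zero] at this
    rw [this, Complex.ofReal_one]
  | more n ih1 ih2 =>
    have h1 : D (n + 2) =ᵐ[volume.restrict S.E] fun t => (z - S.b (n + 2)) * D (n + 1) t -
        S.a (n + 1) * D n t + S.evalP (n + 1) (t : ℂ) * (S.w t : ℂ) := by
      filter_upwards [ae_restrict_of_ae hne] with t ht
      have hrec : ∀ y : ℂ, S.evalP (n + 2) y =
          (y - S.b (n + 2)) * S.evalP (n + 1) y - S.a (n + 1) * S.evalP n y := by
        intro y
        rw [evalP, P_add_two]
        simp [evalP]
      simp only [hD]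
      rw [hrec, hrec]
      field_simp
      ring
    have hi1 := ih2.1.const_mul (z - S.b (n + 2))
    have hi2 := ih1.1.const_mul (S.a (n + 1) : ℂ)
    refine ⟨((hi1.sub hi2).add (hPw (n + 1)).1).congr h1.symm, ?_⟩
    rw [integral_congr_ae h1]
    have h2 := integral_add (hi1.sub hi2) (hPw (n + 1)).1
    have h3 := integral_sub hi1 hi2
    simp only [Pi.sub_apply] at h2
    rw [h2, h3, integral_const_mul, integral_const_mul, ih1.2, ih2.2, (hPw (n + 1)).2,
      ip_one_P_succ, Q_add_two]
    simp

theorem aeval_two_mul_P_add {M : ℕ} (hM : S.HasPeriod M) (hpos : 1 ≤ M) (z : ℂ)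
    {n : ℕ} (hn : 1 ≤ n) :
    2 * aeval z (S.P (n + M)) =
      aeval z (S.P n) * aeval z (S.P M) + aeval z (S.Q n) * aeval z (S.W M) ∧
    2 * aeval z (S.Q (n + M)) =
      aeval z (S.P n) * aeval z (S.Q M) + aeval z (S.Q n) * aeval z (S.P M) := by
  obtain ⟨k, rfl⟩ : ∃ k, n = k + 1 := ⟨n - 1, by omega⟩
  have h1 := congrArg (aeval z) (S.two_mul_P_add hM hpos k).1
  have h2 := congrArg (aeval z) (S.two_mul_P_add hM hpos k).2
  simp only [map_mul, map_add, map_ofNat] at h1 h2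
  exact ⟨h1, h2⟩

theorem aeval_P_sq_sub {M : ℕ} (hM : S.HasPeriod M) (hpos : 1 ≤ M) (z : ℂ) :
    aeval z (S.P M) ^ 2 - aeval z (S.Q M) * aeval z (S.W M) = 2 * (S.h M : ℂ) := by
  have h1 := congrArg (aeval z) (S.P_sq_sub hM hpos)
  simpa only [map_mul, map_sub, map_pow, map_ofNat, aeval_C, Complex.coe_algebraMap] using h1

/-- With k = n - M, multiplying 2(P_n + Q_n/ψ) = (P_k + Q_k/ψ)(P_M + Q_M/ψ) by P_M - Q_M/ψ produces
the norm 2h_M. -/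
theorem product_of_gt {M : ℕ} (hM : S.HasPeriod M) (hpos : 1 ≤ M) (z : ℂ)
    {n : ℕ} (h : M < n) :
    S.evalP n z * S.evalP M z = S.evalP (n + M) z + (S.h M : ℂ) / 2 * S.evalP (n - M) z ∧
    S.evalQ n z * S.evalP M z = S.evalQ (n + M) z + (S.h M : ℂ) / 2 * S.evalQ (n - M) z := by
  obtain ⟨k, hk, rfl⟩ : ∃ k, 1 ≤ k ∧ n = k + M := ⟨n - M, by omega, by omega⟩
  rw [Nat.add_sub_cancel]
  obtain ⟨h1, h2⟩ := S.aeval_two_mul_P_add hM hpos z hk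
  obtain ⟨h3, h4⟩ := S.aeval_two_mul_P_add hM hpos z (n := k + M) (by omega)
  have h5 := S.aeval_P_sq_sub hM hpos z
  simp only [evalP, evalQ_eq]
  constructor
  · linear_combination (-1 / 2 : ℂ) * h3 + (1 / 4 : ℂ) * aeval z (S.P M) * h1 -
      (1 / 4 : ℂ) * aeval z (S.W M) * h2 + (1 / 4 : ℂ) * aeval z (S.P k) * h5
  · linear_combination (-1 / 2 : ℂ) * h4 + (1 / 4 : ℂ) * aeval z (S.P M) * h2 -
      (1 / 4 : ℂ) * aeval z (S.Q M) * h1 + (1 / 4 : ℂ) * aeval z (S.Q k) * h5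

theorem product_self {M : ℕ} (hM : S.HasPeriod M) (hpos : 1 ≤ M) (z : ℂ) :
    S.evalP M z * S.evalP M z = S.evalP (M + M) z + (S.h M : ℂ) ∧
    S.evalQ M z * S.evalP M z = S.evalQ (M + M) z := by
  obtain ⟨h1, h2⟩ := S.aeval_two_mul_P_add hM hpos z hpos
  have h5 := S.aeval_P_sq_sub hM hpos z
  simp only [evalP, evalQ_eq]
  constructor
  · linear_combination (-1 / 2 : ℂ) * h1 + (1 / 2 : ℂ) * h5
  · linear_combination (-1 / 2 : ℂ) * h2

theorem aeval_reflection {M : ℕ} (hM : S.HasPeriod M) (z : ℂ)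
    {j : ℕ} (hj : 1 ≤ j) (hjM : j < M) :
    aeval z (S.P M) * aeval z (S.P j) - aeval z (S.Q j) * aeval z (S.W M) =
      S.h j * aeval z (S.P (M - j)) ∧
    aeval z (S.Q M) * aeval z (S.P j) - aeval z (S.P M) * aeval z (S.Q j) =
      S.h j * aeval z (S.Q (M - j)) := by
  have h1 := congrArg (aeval z) (S.reflection hM hj hjM).1
  have h2 := congrArg (aeval z) (S.reflection hM hj hjM).2
  simp only [map_mul, map_sub, aeval_C, Complex.coe_algebraMap] at h1 h2
  exact ⟨h1, h2⟩

theorem product_of_lt {M : ℕ} (hM : S.HasPeriod M) (hpos : 1 ≤ M) (z : ℂ)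
    {n : ℕ} (hn : 1 ≤ n) (h : n < M) :
    S.evalP n z * S.evalP M z = S.evalP (n + M) z + (S.h n : ℂ) / 2 * S.evalP (M - n) z ∧
    S.evalQ n z * S.evalP M z = S.evalQ (n + M) z - (S.h n : ℂ) / 2 * S.evalQ (M - n) z := by
  obtain ⟨h1, h2⟩ := S.aeval_two_mul_P_add hM hpos z hn
  obtain ⟨h3, h4⟩ := S.aeval_reflection hM z hn h
  simp only [evalP, evalQ_eq]
  constructor
  · linear_combination (-1 / 2 : ℂ) * h1 + (1 / 2 : ℂ) * h3
  · linear_combination (-1 / 2 : ℂ) * h2 - (1 / 2 : ℂ) * h4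

theorem evalQ_zero (z : ℂ) : S.evalQ 0 z = 0 := by rw [evalQ_eq, Q_zero, map_zero]

/-- At ±1 and β_j both sides are 0: `denom` vanishes while `numer` does not, and on the right the
division is by zero. -/
theorem aeval_W {M : ℕ} (hM : S.HasPeriod M) (hpos : 1 ≤ M) {z : ℂ} (hz : ∀ i, z ≠ S.α i) :
    aeval z (S.W M) = aeval z (S.Q M) / S.psi z ^ 2 := by
  have h1 := congrArg (aeval z) (S.two_mul_Q_succ_and_W hM hpos).2.1
  rw [map_mul, map_mul] at h1
  have h2 : aeval z S.numer ≠ 0 := by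
    rw [aeval_numer, Finset.prod_ne_zero_iff]
    exact fun i _ => sub_ne_zero.2 (hz i)
  rw [S.psi_sq hz, div_div_eq_mul_div, eq_div_iff h2, h1]

end BranchPoints

theorem lemma1 {g : ℕ} (S : BranchPoints g) (K : ℕ) (hK : 1 ≤ K) (hper : S.HasPeriod K) :
    -- products `P_n P_{mK}`, with the exact form in the case `n = mK`
    (∀ m n : ℕ, 1 ≤ m → m * K < n → ∀ z : ℂ,
      S.evalP n z * S.evalP (m * K) z =
        S.evalP (n + m * K) z + (S.h (m * K) : ℂ) / 2 * S.evalP (n - m * K) z) ∧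
    (∀ m n : ℕ, 1 ≤ n → n < m * K → ∀ z : ℂ,
      S.evalP n z * S.evalP (m * K) z =
        S.evalP (n + m * K) z + (S.h n : ℂ) / 2 * S.evalP (m * K - n) z) ∧
    (∀ m : ℕ, 1 ≤ m → ∀ z : ℂ,
      S.evalP (m * K) z * S.evalP (m * K) z =
        S.evalP (2 * (m * K)) z + (S.h (m * K) : ℂ)) ∧
    -- products `Q_n P_{mK}`
    (∀ m n : ℕ, 1 ≤ m → m * K ≤ n → ∀ z : ℂ,
      S.evalQ n z * S.evalP (m * K) z =
        S.evalQ (n + m * K) z + (S.h (m * K) : ℂ) / 2 * S.evalQ (n - m * K) z) ∧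
    (∀ m n : ℕ, 1 ≤ n → n ≤ m * K → ∀ z : ℂ,
      S.evalQ n z * S.evalP (m * K) z =
        S.evalQ (n + m * K) z - (S.h n : ℂ) / 2 * S.evalQ (m * K - n) z) ∧
    -- `P_{nK-j}` and `Q_{nK-j}`
    (∀ n j : ℕ, 1 ≤ n → 1 ≤ j → j < K → ∀ z : ℂ, (∀ i, z ≠ (S.α i : ℂ)) →
      S.evalP (n * K - j) z =
        1 / (S.h j : ℂ) * (S.evalP (n * K) z * S.evalP j z -
          S.evalQ (n * K) z * S.evalQ j z / S.psi z ^ 2)) ∧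
    (∀ n j : ℕ, 1 ≤ n → 1 ≤ j → j < K → ∀ z : ℂ,
      S.evalQ (n * K - j) z =
        1 / (S.h j : ℂ) * (S.evalQ (n * K) z * S.evalP j z -
          S.evalP (n * K) z * S.evalQ j z)) := by
  have hpos : ∀ m, 1 ≤ m → 1 ≤ m * K := fun m hm => Nat.mul_pos hm hK
  have hh : ∀ j, (S.h j : ℂ) ≠ 0 := fun j => by exact_mod_cast (S.h_pos j).ne'
  have hlt : ∀ {n j : ℕ}, 1 ≤ n → j < K → j < n * K := fun hn hj =>
    hj.trans_le (Nat.le_mul_of_pos_left K hn)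
  refine ⟨fun m n hm hn z => (S.product_of_gt (hper.mul m) (hpos m hm) z hn).1,
    fun m n hn hnm z => (S.product_of_lt (hper.mul m) (by omega) z hn hnm).1,
    fun m hm z => ?_, fun m n hm hn z => ?_, fun m n hn hnm z => ?_,
    fun n j hn hj hjK z hz => ?_, fun n j hn hj hjK z => ?_⟩
  · rw [two_mul]
    exact (S.product_self (hper.mul m) (hpos m hm) z).1
  · rcases hn.eq_or_lt with rfl | hn
    · rw [Nat.sub_self, S.evalQ_zero, mul_zero, add_zero]
      exact (S.product_self (hper.mul m) (hpos m hm) z).2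
    · exact (S.product_of_gt (hper.mul m) (hpos m hm) z hn).2
  · rcases hnm.eq_or_lt with rfl | hnm
    · rw [Nat.sub_self, S.evalQ_zero, mul_zero, sub_zero]
      exact (S.product_self (hper.mul m) hn z).2
    · exact (S.product_of_lt (hper.mul m) (by omega) z hn hnm).2
  · have h1 := (S.aeval_reflection (hper.mul n) z hj (hlt hn hjK)).1
    rw [S.aeval_W (hper.mul n) (hpos n hn) hz] at h1
    simp only [BranchPoints.evalP, BranchPoints.evalQ_eq]
    rw [one_div, eq_inv_mul_iff_mul_eq₀ (hh j), ← h1]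
    ring
  · have h1 := (S.aeval_reflection (hper.mul n) z hj (hlt hn hjK)).2
    simp only [BranchPoints.evalP, BranchPoints.evalQ_eq]
    rw [one_div, eq_inv_mul_iff_mul_eq₀ (hh j), ← h1]
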